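/- Let $V$ be a smooth ($C^\infty$) finite-dimensional manifold without boundary, Hausdorff and exhausted by an increasing sequence of compact domains. For an integer $k\ge 0$ let $C^k(V)$ be the Fréchet space of $k$-times continuously differentiable real-valued functions on $V$ with the $C^k$ topology (uniform convergence on compact sets of all partial derivatives of order at most $k$, in charts), and let $C^\infty(V)=\bigcap_k C^k(V)$. A subset $C$ of a linear topological space is called $\infty$-convex if for every bounded sequence $(x_i)_{i\ge 0}$ in $C$ and all reals $t_i\ge 0$ with $\sum_{i\ge 0}t_i=1$ the series $\sum_{i\ge 0} t_ix_i$ converges to a point of $C$. A closed subset $B$ of a separable metrizable space $Y$ is a $Z$-set if every continuous map from the Hilbert cube $Q$ to $Y$ can be uniformly approximated by continuous maps $Q\to Y$ whose images miss $B$; a $\sigma Z$-subset of $Y$ is a countable union of $Z$-sets of $Y$. Let $\mathcal M_2$ be the class of topological spaces homeomorphic to $F_{\sigma\delta}$-subsets of metrizable compacta. A space $Y$ is $\mathcal M_2$-universal if every space in $\mathcal M_2$ is homeomorphic to a closed subset of $Y$. Let $l\ge 0$ be an integer and let $C^l_\bullet$ be an $\infty$-convex $G_\delta$-subset of $C^l(V)$.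 For an integer $k\ge l$ put $C^k_\bullet=C^l_\bullet\cap C^k(V)$ with the subspace topology from $C^k(V)$, and put $C^\infty_\bullet=C^l_\bullet\cap C^\infty(V)$. Let $n\ge l$ be an integer such that $C^n_\bullet\neq\emptyset$ and such that for every integer $k\ge n$ the set $C^\infty_\bullet$ is dense in $C^k_\bullet$, and $C^{k+1}_\bullet$ is contained in a $\sigma Z$-subset of $C^k_\bullet$. If $f\colon C^n_\bullet\to X$ is a continuous injective map to a Hausdorff topological space $X$, then the subspace $f(C^\infty_\bullet)$ of $X$ is $\mathcal M_2$-universal. -/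

import Mathlib

open Set Filter Topology
open scoped Manifold ContDiff

universe u v w

noncomputable section

/-! ### The spaces `C^γ(V)` -/

/-- The set `C^γ(V)` of real-valued functions of class `C^γ` on the smooth `m`-manifold `V`,
for `γ` a natural number or `∞`. -/
def CSpace (m : ℕ) (V : Type u) [TopologicalSpace V]
    [ChartedSpace (EuclideanSpace ℝ (Fin m)) V] (γ : ℕ∞) : Type u :=
  ContMDiffMap (𝓡 m) 𝓘(ℝ, ℝ) V ℝ (γ : WithTop ℕ∞)

namespace CSpace

section Algebra

variable {m : ℕ} {V : Type u} [TopologicalSpace V]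
  [ChartedSpace (EuclideanSpace ℝ (Fin m)) V] {γ : ℕ∞}

instance instFunLike : FunLike (CSpace m V γ) V ℝ :=
  inferInstanceAs (FunLike (ContMDiffMap (𝓡 m) 𝓘(ℝ, ℝ) V ℝ (γ : WithTop ℕ∞)) V ℝ)

instance instAddCommGroup : AddCommGroup (CSpace m V γ) :=
  inferInstanceAs (AddCommGroup (ContMDiffMap (𝓡 m) 𝓘(ℝ, ℝ) V ℝ (γ : WithTop ℕ∞)))

instance instModule : Module ℝ (CSpace m V γ) :=
  inferInstanceAs (Module ℝ (ContMDiffMap (𝓡 m) 𝓘(ℝ, ℝ) V ℝ (γ : WithTop ℕ∞)))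

theorem contMDiff (f : CSpace m V γ) : ContMDiff (𝓡 m) 𝓘(ℝ, ℝ) (γ : WithTop ℕ∞) (f : V → ℝ) :=
  f.2

theorem coe_add (f g : CSpace m V γ) : ((f + g : CSpace m V γ) : V → ℝ) = f + g := rfl

theorem coe_smul (c : ℝ) (f : CSpace m V γ) : ((c • f : CSpace m V γ) : V → ℝ) = c • f := rfl

/-- A chart `φ` of the atlas, a compact subset `K` of the image of `φ`, and an order `k ≤ γ`. -/
structure SeminormIndex (m : ℕ) (V : Type u) [TopologicalSpace V]
    [ChartedSpace (EuclideanSpace ℝ (Fin m)) V] (γ : ℕ∞) where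
  chart : OpenPartialHomeomorph V (EuclideanSpace ℝ (Fin m))
  chart_mem : chart ∈ atlas (EuclideanSpace ℝ (Fin m)) V
  K : Set (EuclideanSpace ℝ (Fin m))
  isCompact_K : IsCompact K
  K_subset : K ⊆ chart.target
  k : ℕ
  k_le : (k : ℕ∞) ≤ γ

end Algebra

section Topology

variable {m : ℕ} {V : Type u} [TopologicalSpace V]
  [ChartedSpace (EuclideanSpace ℝ (Fin m)) V] [IsManifold (𝓡 m) ∞ V] {γ : ℕ∞}

theorem contDiffOn_comp_symm (f : CSpace m V γ) (i : SeminormIndex m V γ) :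
    ContDiffOn ℝ (i.k : WithTop ℕ∞) ((f : V → ℝ) ∘ i.chart.symm) i.chart.target := by
  have hk : (i.k : WithTop ℕ∞) ≤ (γ : WithTop ℕ∞) := by exact_mod_cast i.k_le
  have hk' : (i.k : WithTop ℕ∞) ≤ ∞ := by exact_mod_cast le_top (a := (i.k : ℕ∞))
  have h1 : ContMDiffOn (𝓡 m) (𝓡 m) (i.k : WithTop ℕ∞) i.chart.symm i.chart.target :=
    (contMDiffOn_symm_of_mem_maximalAtlas
      (IsManifold.subset_maximalAtlas (n := ∞) i.chart_mem)).of_le hk'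
  exact ((f.contMDiff.of_le hk).comp_contMDiffOn h1).contDiffOn

theorem contDiffAt_comp_symm (f : CSpace m V γ) (i : SeminormIndex m V γ)
    {y : EuclideanSpace ℝ (Fin m)} (hy : y ∈ i.K) :
    ContDiffAt ℝ (i.k : WithTop ℕ∞) ((f : V → ℝ) ∘ i.chart.symm) y :=
  (f.contDiffOn_comp_symm i).contDiffAt (i.chart.open_target.mem_nhds (i.K_subset hy))

theorem bddAbove_norm (f : CSpace m V γ) (i : SeminormIndex m V γ) :
    BddAbove (range fun y : i.K =>
      ‖iteratedFDeriv ℝ i.k ((f : V → ℝ) ∘ i.chart.symm) (y : EuclideanSpace ℝ (Fin m))‖) := by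
  have h : ContinuousOn (iteratedFDeriv ℝ i.k ((f : V → ℝ) ∘ i.chart.symm)) i.K := by
    refine ContinuousOn.mono ?_ i.K_subset
    refine ((f.contDiffOn_comp_symm i).continuousOn_iteratedFDerivWithin le_rfl
      i.chart.open_target.uniqueDiffOn).congr ?_
    intro y hy
    exact (iteratedFDerivWithin_of_isOpen i.k i.chart.open_target hy).symm
  have h2 := (i.isCompact_K.image_of_continuousOn h.norm).bddAbove
  rwa [image_eq_range] at h2

/-- The seminorm `f ↦ sup_{y ∈ K} ‖D^k (f ∘ φ⁻¹)(y)‖`. -/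
def seminorm (i : SeminormIndex m V γ) : Seminorm ℝ (CSpace m V γ) :=
  Seminorm.of
    (fun f => ⨆ y : i.K,
      ‖iteratedFDeriv ℝ i.k ((f : V → ℝ) ∘ i.chart.symm) (y : EuclideanSpace ℝ (Fin m))‖)
    (by
      intro f g
      refine Real.iSup_le (fun y => ?_) (add_nonneg (Real.iSup_nonneg fun _ => norm_nonneg _)
        (Real.iSup_nonneg fun _ => norm_nonneg _))
      have h : ((f + g : CSpace m V γ) : V → ℝ) ∘ i.chart.symm
          = ((f : V → ℝ) ∘ i.chart.symm) + ((g : V → ℝ) ∘ i.chart.symm) := rfl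
      rw [h, iteratedFDeriv_add_apply (f.contDiffAt_comp_symm i y.2)
        (g.contDiffAt_comp_symm i y.2)]
      exact (norm_add_le _ _).trans
        (add_le_add (le_ciSup (f.bddAbove_norm i) y) (le_ciSup (g.bddAbove_norm i) y)))
    (by
      intro c f
      rw [Real.mul_iSup_of_nonneg (norm_nonneg c)]
      congr 1
      funext y
      have h : ((c • f : CSpace m V γ) : V → ℝ) ∘ i.chart.symm
          = c • ((f : V → ℝ) ∘ i.chart.symm) := rfl
      rw [h, iteratedFDeriv_const_smul_apply (f.contDiffAt_comp_symm i y.2), norm_smul])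

variable (m V γ) in
/-- The family of all these seminorms. -/
def seminormFamily : SeminormFamily ℝ (CSpace m V γ) (SeminormIndex m V γ) := fun i => seminorm i

/-- The `C^γ` topology, of uniform convergence on compact sets (inside charts) of all
derivatives of order at most `γ`. -/
instance instTopologicalSpace : TopologicalSpace (CSpace m V γ) :=
  (seminormFamily m V γ).moduleFilterBasis.topology

theorem withSeminorms : WithSeminorms (seminormFamily m V γ) := ⟨rfl⟩

end Topology

section Restriction

variable {m : ℕ} {V : Type u} [TopologicalSpace V]
  [ChartedSpace (EuclideanSpace ℝ (Fin m)) V]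

/-- For a set `S` of `C^β` functions, the set `S ∩ C^γ(V)`, as a subset of `C^γ(V)`. -/
def inter {β : ℕ∞} (S : Set (CSpace m V β)) (γ : ℕ∞) : Set (CSpace m V γ) :=
  {f | ∃ g ∈ S, (g : V → ℝ) = f}

/-- For sets of functions `S ⊆ C^β(V)` and `T ⊆ C^γ(V)`, the set `S ∩ T`, as a subset of `T`. -/
def interIn {β γ : ℕ∞} (S : Set (CSpace m V β)) (T : Set (CSpace m V γ)) : Set T :=
  {f | ∃ g ∈ S, (g : V → ℝ) = f.1}

end Restriction

end CSpace

/-! ### Convexity and Z-sets -/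

/-- A set `C` is `∞`-convex if for every bounded sequence `x` in `C` and all weights `t i ≥ 0` of
sum `1`, the series `∑ t i • x i` converges to a point of `C`. -/
def IsInftyConvex {E : Type u} [AddCommGroup E] [Module ℝ E] [TopologicalSpace E]
    (C : Set E) : Prop :=
  ∀ x : ℕ → E, (∀ i, x i ∈ C) → Bornology.IsVonNBounded ℝ (range x) →
    ∀ t : ℕ → ℝ, (∀ i, 0 ≤ t i) → HasSum t 1 →
      ∃ y ∈ C, Tendsto (fun N => ∑ i ∈ Finset.range N, t i • x i) atTop (𝓝 y)

/-- The Hilbert cube. -/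
abbrev HilbertCube : Type := ℕ → unitInterval

/-- A closed set `B` is a Z-set if every map from the Hilbert cube to `X` is a uniform limit of
maps that miss `B`. As the Hilbert cube is compact, uniform convergence (for any compatible
metric on `X`) is convergence in the compact-open topology of `C(HilbertCube, X)`. -/
def IsZSet {X : Type u} [TopologicalSpace X] (B : Set X) : Prop :=
  IsClosed B ∧ Dense {g : C(HilbertCube, X) | ∀ q, g q ∉ B}

/-- A `σZ`-subset is a countable union of Z-sets. -/
def IsSigmaZSet {X : Type u} [TopologicalSpace X] (Y : Set X) : Prop :=
  ∃ Z : ℕ → Set X, (∀ i, IsZSet (Z i)) ∧ Y = ⋃ i, Z i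

/-! ### The class `M₂` -/

/-- `F_{σδ}`-sets: countable intersections of countable unions of closed sets. -/
def IsFSigmaDelta {K : Type u} [TopologicalSpace K] (S : Set K) : Prop :=
  ∃ F : ℕ → ℕ → Set K, (∀ i j, IsClosed (F i j)) ∧ S = ⋂ i, ⋃ j, F i j

/-- The class `M₂` of spaces homeomorphic to `F_{σδ}`-sets in metrizable compacta. -/
def IsM2 (M : Type u) [TopologicalSpace M] : Prop :=
  ∃ (K : Type u) (_ : TopologicalSpace K) (_ : CompactSpace K)
    (_ : TopologicalSpace.MetrizableSpace K) (S : Set K),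
    IsFSigmaDelta S ∧ Nonempty (M ≃ₜ S)

/-- `X` is `M₂`-universal if each space in `M₂` is homeomorphic to a closed subset of `X`.
(The universe `w` of the spaces in `M₂` is immaterial, such spaces being copies of subsets of the
Hilbert cube.) -/
def IsM2Universal (X : Type u) [TopologicalSpace X] : Prop :=
  ∀ (M : Type w) [TopologicalSpace M], IsM2 M →
    ∃ A : Set X, IsClosed A ∧ Nonempty (M ≃ₜ A)

end

/-! ### Vector spaces with an F-norm whose balls are convex -/

/-- The balls about `0` of an additive norm on a real vector space are convex. -/
class HasConvexBalls (G : Type*) [NormedAddCommGroup G] [Module ℝ G] : Prop where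
  convex_ball_zero : ∀ r : ℝ, Convex ℝ (Metric.ball (0 : G) r)

namespace HasConvexBalls

variable {G : Type*} [NormedAddCommGroup G] [Module ℝ G] [HasConvexBalls G]

theorem convex_ball (x : G) (r : ℝ) : Convex ℝ (Metric.ball x r) := by
  have h : Metric.ball x r = (fun z => x + z) '' Metric.ball (0 : G) r := by
    ext y
    simp only [Metric.mem_ball, dist_eq_norm, mem_image, sub_zero]
    exact ⟨fun h => ⟨y - x, h, by abel⟩, by rintro ⟨z, hz, rfl⟩; simpa using hz⟩
  rw [h]
  exact (convex_ball_zero r).translate x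

theorem convex_closedBall_zero (r : ℝ) : Convex ℝ (Metric.closedBall (0 : G) r) := by
  have h : Metric.closedBall (0 : G) r = ⋂ n : ℕ, Metric.ball (0 : G) (r + 1 / (n + 1)) := by
    ext y
    simp only [Metric.mem_closedBall, dist_zero_right, mem_iInter, Metric.mem_ball]
    refine ⟨fun h n => by have : (0 : ℝ) < 1 / (n + 1) := by positivity
                          linarith, fun h => le_of_forall_pos_lt_add fun ε hε => ?_⟩
    obtain ⟨n, hn⟩ := exists_nat_one_div_lt hε
    exact (h n).trans (by linarith)
  rw [h]
  exact convex_iInter fun n => convex_ball_zero _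

/-- The point `t • x` lies on the segment from `-x` to `x`, inside a convex symmetric ball. This
replaces homogeneity, which an F-norm lacks. -/
theorem norm_smul_le {t : ℝ} (ht : |t| ≤ 1) (x : G) : ‖t • x‖ ≤ ‖x‖ := by
  have h := convex_closedBall_zero (G := G) ‖x‖
  have h1 : x ∈ Metric.closedBall (0 : G) ‖x‖ := by simp
  have h2 : -x ∈ Metric.closedBall (0 : G) ‖x‖ := by simp
  rw [abs_le] at ht
  have h3 := h h1 h2 (a := (1 + t) / 2) (b := (1 - t) / 2) (by linarith) (by linarith) (by ring)
  have h4 : ((1 + t) / 2) • x + ((1 - t) / 2) • (-x) = t • x := by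
    rw [smul_neg, ← sub_eq_add_neg, ← sub_smul]; congr 1; ring
  rw [h4] at h3
  simpa using h3

end HasConvexBalls

/-! ### Compactness margins and approximation off Z-sets -/

/-- A compact image in an open set has a uniform neighbourhood there. All open conditions imposed at
finite stages survive in the limit through such margins. -/
theorem IsCompact.exists_margin {P G : Type*} [TopologicalSpace P] [NormedAddCommGroup G]
    {L : Set P} (hL : IsCompact L) {f : P → G} (hf : ContinuousOn f L) {O : Set G} (hO : IsOpen O)
    (h : ∀ p ∈ L, f p ∈ O) : ∃ δ > 0, ∀ p ∈ L, ∀ z, ‖z - f p‖ < δ → z ∈ O := by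
  obtain ⟨δ, hδ, hsub⟩ := (hL.image_of_continuousOn hf).exists_thickening_subset_open hO
    (image_subset_iff.2 h)
  refine ⟨δ, hδ, fun p hp z hz => hsub ?_⟩
  rw [Metric.mem_thickening_iff]
  exact ⟨f p, mem_image_of_mem _ hp, by rwa [dist_eq_norm]⟩

/-- Maps from the Hilbert cube to `E` can be approximated by maps to `E ∩ O`. -/
def ApproxInto {G : Type*} [NormedAddCommGroup G] (E O : Set G) : Prop :=
  ∀ F : C(HilbertCube, G), (∀ q, F q ∈ E) → ∀ δ > 0,
    ∃ F' : C(HilbertCube, G), (∀ q, F' q ∈ E ∩ O) ∧ ∀ q, ‖F' q - F q‖ < δ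

theorem ApproxInto.univ {G : Type*} [NormedAddCommGroup G] (E : Set G) :
    ApproxInto E Set.univ :=
  fun F hF δ hδ => ⟨F, fun q => ⟨hF q, mem_univ _⟩, fun q => by simpa using hδ⟩

/-- The first approximation has a margin in the open set `O`, by compactness of the cube; the second
is chosen finer than this margin. -/
theorem ApproxInto.inter {G : Type*} [NormedAddCommGroup G] {E O O' : Set G} (hO : IsOpen O)
    (h : ApproxInto E O) (h' : ApproxInto E O') : ApproxInto E (O ∩ O') := by
  intro F hF δ hδ
  obtain ⟨F₁, h₁, h₁'⟩ := h F hF (δ / 2) (by positivity)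
  obtain ⟨ρ, hρ, hm⟩ := isCompact_univ.exists_margin F₁.continuous.continuousOn hO
    fun p _ => (h₁ p).2
  obtain ⟨F₂, h₂, h₂'⟩ := h' F₁ (fun q => (h₁ q).1) (min ρ (δ / 2)) (by positivity)
  refine ⟨F₂, fun q => ⟨(h₂ q).1, hm q (mem_univ _) _ ((h₂' q).trans_le (min_le_left _ _)),
    (h₂ q).2⟩, fun q => ?_⟩
  calc ‖F₂ q - F q‖ ≤ ‖F₂ q - F₁ q‖ + ‖F₁ q - F q‖ := norm_sub_le_norm_sub_add_norm_sub ..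
    _ < δ / 2 + δ / 2 := add_lt_add ((h₂' q).trans_le (min_le_right _ _)) (h₁' q)
    _ = δ := by ring

theorem ApproxInto.biInter {G : Type*} [NormedAddCommGroup G] {E : Set G} {O : ℕ → Set G}
    (hO : ∀ j, IsOpen (O j)) (h : ∀ j, ApproxInto E (O j)) (n : ℕ) :
    IsOpen (⋂ j < n, O j) ∧ ApproxInto E (⋂ j < n, O j) := by
  induction n with
  | zero => simpa using ApproxInto.univ E
  | succ n ih =>
    rw [biInter_lt_succ]
    exact ⟨ih.1.inter (hO n), ih.2.inter ih.1 (h n)⟩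

/-- The complement of a relatively closed set is the trace of an open set of the ambient group.
Density in the compact-open topology is uniform approximation since the cube is compact. -/
theorem IsZSet.exists_approxInto {G : Type u} [NormedAddCommGroup G] {E : Set G} {Z : Set ↥E}
    (hZ : IsZSet Z) : ∃ O : Set G, IsOpen O ∧ (∀ f : ↥E, f ∈ Z ↔ (f : G) ∉ O) ∧ ApproxInto E O := by
  obtain ⟨O, hO, hOZ⟩ := isOpen_induced_iff.1 hZ.1.isOpen_compl
  have hmem : ∀ f : ↥E, f ∈ Z ↔ (f : G) ∉ O := fun f => by
    have := Set.ext_iff.1 hOZ f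
    simp only [mem_preimage, mem_compl_iff] at this
    tauto
  refine ⟨O, hO, hmem, fun F hF δ hδ => ?_⟩
  obtain ⟨F', hF', hd⟩ := hZ.2.exists_dist_lt
    (⟨fun q => ⟨F q, hF q⟩, F.continuous.subtype_mk _⟩ : C(HilbertCube, ↥E)) hδ
  refine ⟨⟨fun q => (F' q : G), continuous_subtype_val.comp F'.continuous⟩,
    fun q => ⟨(F' q).2, ?_⟩, fun q => ?_⟩
  · have := (hmem (F' q)).not.1 (hF' q)
    simpa using this
  · have := (ContinuousMap.dist_lt_iff hδ).1 hd q
    rw [Subtype.dist_eq, dist_comm, dist_eq_norm] at this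
    exact this

/-! ### Approximate selections over a compact metrizable space -/

section Approximation

variable {G : Type u} [NormedAddCommGroup G] [Module ℝ G] [ContinuousSMul ℝ G] [HasConvexBalls G]
  {K : Type w} [TopologicalSpace K] [CompactSpace K] [TopologicalSpace.MetrizableSpace K]

/-- A family of convex subsets of `E` over a compact space, with continuous sections near every
point of `E`. -/
structure IsDenseFamily (E : Set G) (T : K → Set G) : Prop where
  convex : ∀ x, Convex ℝ (T x)
  subset : ∀ x, T x ⊆ E
  exists_section : ∀ y ∈ E, ∀ δ > 0, ∃ s : K → G, Continuous s ∧ ∀ x, s x ∈ T x ∧ ‖s x - y‖ < δ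

/-- Embed `K` in the Hilbert cube. A partition of unity extends `q` approximately to the whole cube
with values in the convex set `E`; the extension is approximated there and restricted back to `K`.
-/
theorem ApproxInto.exists_map {E O : Set G} (hE : Convex ℝ E) (h : ApproxInto E O)
    {q : K → G} (hq : Continuous q) (hqE : ∀ x, q x ∈ E) {δ : ℝ} (hδ : 0 < δ) :
    ∃ q' : K → G, Continuous q' ∧ (∀ x, q' x ∈ E ∩ O) ∧ ∀ x, ‖q' x - q x‖ < δ := by
  classical
  rcases isEmpty_or_nonempty K with hK | ⟨⟨x₀⟩⟩
  · exact ⟨q, hq, fun x => isEmptyElim x, fun x => isEmptyElim x⟩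
  let _ := TopologicalSpace.metrizableSpaceMetric K
  obtain ⟨j, hj⟩ := Metric.PiNatEmbed.exists_embedding_to_hilbert_cube (X := K)
  have hjc : IsClosedEmbedding j := hj.continuous.isClosedEmbedding hj.injective
  obtain ⟨F, hF⟩ := exists_continuous_forall_mem_convex_of_local_const (X := HilbertCube) (E := G)
    (t := fun y => {f | f ∈ E ∧ ∀ x, j x = y → f ∈ Metric.ball (q x) (δ / 2)})
    (fun y => by
      have : {f | f ∈ E ∧ ∀ x, j x = y → f ∈ Metric.ball (q x) (δ / 2)}
          = E ∩ ⋂ x, ⋂ _ : j x = y, Metric.ball (q x) (δ / 2) := by ext; simp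
      rw [this]
      exact hE.inter (convex_iInter fun x => convex_iInter fun _ => HasConvexBalls.convex_ball _ _))
    (fun y => by
      by_cases hy : y ∈ range j
      · obtain ⟨x, rfl⟩ := hy
        refine ⟨q x, ?_⟩
        have hcl : IsClosed (j '' {x' | δ / 2 ≤ dist (q x) (q x')}) :=
          hjc.isClosedMap _ (isClosed_le continuous_const (continuous_const.dist hq))
        filter_upwards [hcl.isOpen_compl.mem_nhds (x := j x) (by
          rintro ⟨x', hx', he⟩
          rw [hj.injective he] at hx'
          simp only [mem_ofPred_eq, dist_self] at hx'
          linarith)] with z hz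
        refine ⟨hqE x, fun x' hx' => ?_⟩
        by_contra hcon
        exact hz ⟨x', by simpa [Metric.mem_ball] using hcon, hx'⟩
      · refine ⟨q x₀, ?_⟩
        filter_upwards [hjc.isClosed_range.isOpen_compl.mem_nhds hy] with z hz
        exact ⟨hqE x₀, fun x hx => absurd ⟨x, hx⟩ hz⟩)
  obtain ⟨F', hF', hd⟩ := h F (fun y => (hF y).1) (δ / 2) (by positivity)
  refine ⟨fun x => F' (j x), F'.continuous.comp hj.continuous, fun x => hF' _, fun x => ?_⟩
  have h1 := (hF (j x)).2 x rfl
  rw [Metric.mem_ball, dist_eq_norm] at h1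
  calc ‖F' (j x) - q x‖ ≤ ‖F' (j x) - F (j x)‖ + ‖F (j x) - q x‖ :=
        norm_sub_le_norm_sub_add_norm_sub ..
    _ < δ / 2 + δ / 2 := add_lt_add (hd _) h1
    _ = δ := by ring

/-- Push `q` into `O` with values in `E`, then return to the sets `T x` within the margin in `O`:
local sections near the pushed map are glued by a partition of unity, which stays in `T x` and in
small balls because both are convex. -/
theorem IsDenseFamily.exists_approx {E O : Set G} (hE : Convex ℝ E) (hO : IsOpen O)
    (h : ApproxInto E O) {T : K → Set G} (hT : IsDenseFamily E T)
    {q : K → G} (hq : Continuous q) (hqE : ∀ x, q x ∈ E) {δ : ℝ} (hδ : 0 < δ) :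
    ∃ q' : K → G, Continuous q' ∧ (∀ x, q' x ∈ T x ∩ O) ∧ ∀ x, ‖q' x - q x‖ < δ := by
  obtain ⟨q₁, hc₁, h₁, hd₁⟩ := h.exists_map hE hq hqE (half_pos hδ)
  obtain ⟨ρ, hρ, hm⟩ := isCompact_univ.exists_margin hc₁.continuousOn hO fun p _ => (h₁ p).2
  set ε := min ρ (δ / 2)
  have hε : 0 < ε := by positivity
  let _ := TopologicalSpace.metrizableSpaceMetric K
  obtain ⟨q', hq'⟩ := exists_continuous_forall_mem_convex_of_local (X := K) (E := G)
    (t := fun x => T x ∩ Metric.ball (q₁ x) ε)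
    (fun x => (hT.convex x).inter (HasConvexBalls.convex_ball _ _))
    (fun x => by
      obtain ⟨s, hs, hsT⟩ := hT.exists_section (q₁ x) (h₁ x).1 (ε / 2) (by positivity)
      refine ⟨{y | dist (q₁ x) (q₁ y) < ε / 2}, ?_, s, hs.continuousOn, fun y hy => ⟨(hsT y).1, ?_⟩⟩
      · exact (isOpen_lt (continuous_const.dist hc₁) continuous_const).mem_nhds (by simpa using hε)
      · have h2 := (hsT y).2
        rw [← dist_eq_norm] at h2
        exact (dist_triangle _ (q₁ x) _).trans_lt (by linarith [show dist (q₁ x) (q₁ y) < ε / 2 from hy]))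
  have hb : ∀ x, ‖q' x - q₁ x‖ < ε := fun x => by
    have := (hq' x).2
    rwa [Metric.mem_ball, dist_eq_norm] at this
  refine ⟨q', q'.continuous, fun x => ⟨(hq' x).1, hm x (mem_univ _) _
    ((hb x).trans_le (min_le_left _ _))⟩, fun x => ?_⟩
  calc ‖q' x - q x‖ ≤ ‖q' x - q₁ x‖ + ‖q₁ x - q x‖ := norm_sub_le_norm_sub_add_norm_sub ..
    _ < δ / 2 + δ / 2 := add_lt_add ((hb x).trans_le (min_le_right _ _)) (hd₁ x)
    _ = δ := by ring

end Approximation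

/-! ### Perturbations of prescribed radius -/

theorem exists_seq_of_step {S : Type*} (I : ℕ → S → Prop) (R : ℕ → S → S → Prop) {s₀ : S}
    (h₀ : I 0 s₀) (h : ∀ n s, I n s → ∃ s', I (n + 1) s' ∧ R n s s') :
    ∃ f : ℕ → S, f 0 = s₀ ∧ (∀ n, I n (f n)) ∧ ∀ n, R n (f n) (f (n + 1)) := by
  choose! next hn using h
  let f : ℕ → S := fun n => Nat.rec s₀ (fun n s => next n s) n
  have hf : ∀ n, I n (f n) := fun n => by
    induction n with
    | zero => exact h₀
    | succ n ih => exact (hn n _ ih).1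
  exact ⟨f, rfl, hf, fun n => (hn n _ (hf n)).2⟩

theorem norm_sub_le_of_halving {G : Type*} [NormedAddCommGroup G] {q : ℕ → G} {r : ℝ} {m : ℕ}
    (h : ∀ n ≥ m, ‖q (n + 1) - q n‖ ≤ (1 / 2) ^ (n + 1) * r) {M : ℕ} (hM : m ≤ M) :
    ‖q M - q m‖ ≤ ((1 / 2) ^ m - (1 / 2) ^ M) * r := by
  induction M, hM using Nat.le_induction with
  | base => simp
  | succ M hM ih =>
    calc ‖q (M + 1) - q m‖ ≤ ‖q (M + 1) - q M‖ + ‖q M - q m‖ :=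
          norm_sub_le_norm_sub_add_norm_sub ..
      _ ≤ (1 / 2) ^ (M + 1) * r + ((1 / 2) ^ m - (1 / 2) ^ M) * r := add_le_add (h M hM) ih
      _ = ((1 / 2) ^ m - (1 / 2) ^ (M + 1)) * r := by ring

section Perturbation

variable {G : Type u} [NormedAddCommGroup G] [Module ℝ G] [ContinuousSMul ℝ G] [HasConvexBalls G]
  {K : Type w} [TopologicalSpace K] [CompactSpace K] [TopologicalSpace.MetrizableSpace K]

/-- One step of the construction of a perturbation: the map is pushed into `O` over the shell
`a ≤ r ≤ 2 * a`. -/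
theorem IsDenseFamily.exists_shell {E O : Set G} (hE : Convex ℝ E) (hO : IsOpen O)
    (h : ApproxInto E O) {T : K → Set G} (hT : IsDenseFamily E T)
    {q : K → G} (hq : Continuous q) (hqT : ∀ x, q x ∈ T x)
    {r : K → ℝ} (hr : Continuous r) (hr0 : ∀ x, 0 ≤ r x) {a c : ℝ} (ha : 0 < a) (hc : 0 < c)
    (hqO : ∀ x, 2 * a ≤ r x → q x ∈ O) :
    ∃ q' : K → G, Continuous q' ∧ (∀ x, q' x ∈ T x) ∧ (∀ x, a ≤ r x → q' x ∈ O) ∧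
      (∀ x, ‖q' x - q x‖ ≤ c * r x) ∧ ∀ x, 4 * a ≤ r x → q' x = q x := by
  obtain ⟨ρ, hρ, hm⟩ := (isClosed_le continuous_const hr :
    IsClosed {x | 2 * a ≤ r x}).isCompact.exists_margin hq.continuousOn hO fun x hx => hqO x hx
  obtain ⟨p, hp, hpT, hpq⟩ := hT.exists_approx hE hO h hq (fun x => hT.subset x (hqT x))
    (δ := min ρ (c * (a / 2))) (by positivity)
  -- The cutoff equals 1 for `a ≤ r ≤ 2 * a` and 0 for `r ≤ a / 2` and `r ≥ 4 * a`. Where `r ≥ 2 *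
  -- a` the map is already in `O` and moves less than its margin `ρ`; wherever it moves, `a / 2 ≤
  -- r`, so `c * (a / 2)` is at most `c * r`.
  set s : K → ℝ := fun x => max 0 (min 1 (min (2 * r x / a - 1) (2 - r x / (2 * a)))) with hs
  have hs0 : ∀ x, 0 ≤ s x := fun x => le_max_left _ _
  have hs1 : ∀ x, s x ≤ 1 := fun x => max_le zero_le_one (min_le_left _ _)
  have hsc : Continuous s := by fun_prop
  have hmove : ∀ x, ‖q x + s x • (p x - q x) - q x‖ ≤ ‖p x - q x‖ := fun x => by
    rw [add_sub_cancel_left]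
    exact HasConvexBalls.norm_smul_le (abs_le.2 ⟨by linarith [hs0 x], hs1 x⟩) _
  refine ⟨fun x => q x + s x • (p x - q x), hq.add (hsc.smul (hp.sub hq)), fun x => ?_,
    fun x hx => ?_, fun x => ?_, fun x hx => ?_⟩
  · have := (hT.convex x) (hqT x) (hpT x).1 (a := 1 - s x) (b := s x) (by linarith [hs1 x])
      (hs0 x) (by ring)
    convert this using 1
    beta_reduce
    rw [smul_sub, sub_smul, one_smul]; abel
  · rcases le_total (2 * a) (r x) with h2 | h2
    · exact hm x h2 _ ((hmove x).trans_lt ((hpq x).trans_le (min_le_left _ _)))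
    · have : s x = 1 := by
        have h3 : 1 ≤ 2 * r x / a - 1 := by
          rw [le_sub_iff_add_le, le_div_iff₀ ha]; linarith
        have h4 : 1 ≤ 2 - r x / (2 * a) := by
          have : r x / (2 * a) ≤ 1 := by rw [div_le_one (by positivity)]; exact h2
          linarith
        simp only [hs]
        rw [min_eq_left (le_min h3 h4), max_eq_right zero_le_one]
      beta_reduce
      rw [this, one_smul, add_sub_cancel]
      exact (hpT x).2
  · rcases le_total (r x) (a / 2) with h2 | h2
    · have : s x = 0 := by
        have h3 : 2 * r x / a - 1 ≤ 0 := by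
          rw [sub_nonpos, div_le_one ha]; linarith
        simp only [hs]
        exact max_eq_left ((min_le_right _ _).trans ((min_le_left _ _).trans h3))
      simp only [this, zero_smul, add_zero, sub_self, norm_zero]
      exact mul_nonneg hc.le (hr0 x)
    · calc _ ≤ ‖p x - q x‖ := hmove x
        _ ≤ c * (a / 2) := (hpq x).le.trans (min_le_right _ _)
        _ ≤ c * r x := by gcongr
  · have : s x = 0 := by
      have h3 : 2 - r x / (2 * a) ≤ 0 := by
        have : 2 ≤ r x / (2 * a) := by rw [le_div_iff₀ (by positivity)]; linarith
        linarith
      simp only [hs]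
      exact max_eq_left ((min_le_right _ _).trans ((min_le_right _ _).trans h3))
    simp [this]

/-- A continuous selection of a dense family can be pushed into `O` wherever `r > 0`, moving
each value by at most `r`. -/
theorem IsDenseFamily.exists_perturbation {E O : Set G} (hE : Convex ℝ E) (hO : IsOpen O)
    (h : ApproxInto E O) {T : K → Set G} (hT : IsDenseFamily E T)
    {g : K → G} (hg : Continuous g) (hgT : ∀ x, g x ∈ T x)
    {r : K → ℝ} (hr : Continuous r) (hr0 : ∀ x, 0 ≤ r x) :
    ∃ g' : K → G, Continuous g' ∧ (∀ x, g' x ∈ T x) ∧ (∀ x, ‖g' x - g x‖ ≤ r x) ∧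
      ∀ x, 0 < r x → g' x ∈ O := by
  -- Capping at 1 makes the requirement `2 ≤ r' x` at stage 0 void.
  set r' : K → ℝ := fun x => min (r x) 1 with hr'
  have hrc : Continuous r' := hr.min continuous_const
  have hr'0 : ∀ x, 0 ≤ r' x := fun x => le_min (hr0 x) zero_le_one
  obtain ⟨q, hq0, hqI, hqR⟩ := exists_seq_of_step (S := K → G)
    (fun m q => Continuous q ∧ (∀ x, q x ∈ T x) ∧ ∀ x, 2 * (1 / 2 : ℝ) ^ m ≤ r' x → q x ∈ O)
    (fun m q q' => (∀ x, ‖q' x - q x‖ ≤ (1 / 2) ^ (m + 1) * r' x) ∧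
      ∀ x, 4 * (1 / 2 : ℝ) ^ m ≤ r' x → q' x = q x)
    (s₀ := g) ⟨hg, hgT, fun x hx => by
      have : r' x ≤ 1 := min_le_right _ _
      simp only [pow_zero, mul_one] at hx
      linarith⟩ (by
    rintro m q ⟨hq, hqT, hqO⟩
    obtain ⟨q', h1, h2, h3, h4, h5⟩ := hT.exists_shell hE hO h hq hqT hrc hr'0
      (a := (1 / 2) ^ m) (c := (1 / 2) ^ (m + 1)) (by positivity) (by positivity) hqO
    refine ⟨q', ⟨h1, h2, fun x hx => h3 x ?_⟩, h4, h5⟩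
    calc ((1 : ℝ) / 2) ^ m = 2 * (1 / 2) ^ (m + 1) := by ring
      _ ≤ r' x := hx)
  have hpow : ∀ ε : ℝ, 0 < ε → ∃ N : ℕ, ∀ m ≥ N, 4 * (1 / 2 : ℝ) ^ m ≤ ε := fun ε hε => by
    obtain ⟨N, hN⟩ := exists_pow_lt_of_lt_one (show (0 : ℝ) < ε / 4 by positivity)
      (show (1 / 2 : ℝ) < 1 by norm_num)
    refine ⟨N, fun m hm => ?_⟩
    have := pow_le_pow_of_le_one (by norm_num) (by norm_num : (1 / 2 : ℝ) ≤ 1) hm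
    linarith
  -- The sequence is stationary at each point: it never moves where `r'` vanishes, and elsewhere
  -- stops once the shells lie below `r' x`. Hence the limit stays in `T x`, although `T x` need not
  -- be closed.
  have hst : ∀ x, ∃ N : ℕ, ∀ m ≥ N, q m x = q N x := fun x => by
    obtain ⟨N, hN⟩ : ∃ N : ℕ, ∀ m ≥ N, q (m + 1) x = q m x := by
      rcases (hr'0 x).eq_or_lt with h0 | h0
      · refine ⟨0, fun m _ => ?_⟩
        have := (hqR m).1 x
        rw [← h0, mul_zero] at this
        exact sub_eq_zero.1 (norm_le_zero_iff.1 this)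
      · obtain ⟨N, hN⟩ := hpow _ h0
        exact ⟨N, fun m hm => (hqR m).2 x (hN m hm)⟩
    refine ⟨N, fun m hm => ?_⟩
    induction m, hm using Nat.le_induction with
    | base => rfl
    | succ m hm ih => rw [hN m hm, ih]
  choose N hN using hst
  have hdist : ∀ m x, ‖q (N x) x - q m x‖ ≤ (1 / 2) ^ m * r' x := fun m x => by
    have h1 := norm_sub_le_of_halving (q := fun m => q m x) (m := m) (fun n _ => (hqR n).1 x)
      (le_max_left m (N x))
    rw [hN x _ (le_max_right m (N x))] at h1
    refine h1.trans (mul_le_mul_of_nonneg_right ?_ (hr'0 x))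
    have : (0 : ℝ) ≤ (1 / 2) ^ max m (N x) := by positivity
    linarith
  refine ⟨fun x => q (N x) x, ?_, fun x => (hqI _).2.1 x, fun x => ?_, fun x hx => ?_⟩
  · have : TendstoUniformly q (fun x => q (N x) x) atTop := by
      rw [Metric.tendstoUniformly_iff]
      intro ε hε
      obtain ⟨M, hM⟩ := hpow ε hε
      filter_upwards [eventually_ge_atTop M] with m hm x
      rw [dist_eq_norm]
      have h1 : r' x ≤ 1 := min_le_right _ _
      have h2 : (0 : ℝ) < (1 / 2) ^ m := by positivity
      have h3 := hdist m x
      have h4 := hM m hm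
      nlinarith
    exact this.continuous (Frequently.of_forall fun m => (hqI m).1)
  · have := hdist 0 x
    rw [hq0, pow_zero, one_mul] at this
    exact this.trans (min_le_left _ _)
  · have h0 : 0 < r' x := lt_min hx one_pos
    obtain ⟨M, hM⟩ := hpow _ h0
    have h1 := hM (max M (N x)) (le_max_left _ _)
    have h2 := (hqI (max M (N x))).2.2 x (by
      have : (0 : ℝ) < (1 / 2) ^ max M (N x) := by positivity
      linarith)
    rwa [hN x _ (le_max_right _ _)] at h2

end Perturbation

/-! ### Infinite cubes and disjoint convex families in a convex G_δ-set -/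

section IndependentSequences

variable {W : Type u} [NormedAddCommGroup W] [Module ℝ W]

/-- An infinite-dimensional convex subset of a separable space has a dense sequence that is
linearly independent when seen from the point `e`. -/
theorem exists_dense_independent_seq [ContinuousSMul ℝ W]
    [SecondCountableTopology W]
    {D : Set W} (hD : Convex ℝ D) {e : W} (he : e ∈ D)
    (hinf : ∀ U : Submodule ℝ W, FiniteDimensional ℝ U → ∃ p ∈ D, p - e ∉ U) :
    ∃ y : ℕ → W, (∀ i, y i ∈ D) ∧ (∀ w ∈ D, ∀ δ > 0, ∃ i, ‖y i - w‖ < δ) ∧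
      ∀ n (d : ℕ → ℝ), ∑ i ∈ Finset.range n, d i • (y i - e) = 0 → ∀ i < n, d i = 0 := by
  have : Nonempty ↥D := ⟨⟨e, he⟩⟩
  set q : ℕ → ↥D := TopologicalSpace.denseSeq ↥D
  -- The state is the last vector together with the span of all differences so far. Unpairing the
  -- stage number approximates each point of the dense sequence infinitely often, with errors
  -- tending to 0.
  obtain ⟨f, -, hfI, hfR⟩ := exists_seq_of_step (S := W × Submodule ℝ W)
    (fun _ s => FiniteDimensional ℝ s.2)
    (fun n s s' => s'.1 ∈ D ∧ s'.1 - e ∉ s.2 ∧ ‖s'.1 - q (Nat.unpair n).1‖ < 1 / (n + 1) ∧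
      s.2 ≤ s'.2 ∧ s'.1 - e ∈ s'.2)
    (s₀ := (e, ⊥)) (show FiniteDimensional ℝ (⊥ : Submodule ℝ W) by infer_instance) (by
    rintro n ⟨y, U⟩ (hU : FiniteDimensional ℝ U)
    suffices h : ∃ y' ∈ D, y' - e ∉ U ∧ ‖y' - q (Nat.unpair n).1‖ < 1 / (n + 1) by
      obtain ⟨y', h1, h2, h3⟩ := h
      refine ⟨(y', U ⊔ Submodule.span ℝ {y' - e}), ?_, h1, h2, h3, le_sup_left,
        (le_sup_right : _ ≤ U ⊔ Submodule.span ℝ {y' - e}) (Submodule.mem_span_singleton_self _)⟩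
      show FiniteDimensional ℝ ↥(U ⊔ Submodule.span ℝ {y' - e})
      infer_instance
    set z : W := (q (Nat.unpair n).1).1 with hz
    have hzD : z ∈ D := (q _).2
    have hpos : (0 : ℝ) < 1 / (n + 1) := by positivity
    -- If the target already lies in `e + U`, a small step towards a point `p` of `D` outside `e +
    -- U` leaves `e + U` without leaving `D`.
    by_cases hzU : z - e ∈ U
    · obtain ⟨p, hp, hpU⟩ := hinf U hU
      have hc : Continuous fun t : ℝ => ‖t • (p - z)‖ := by fun_prop
      have h0 : ∀ᶠ t in 𝓝 (0 : ℝ), ‖t • (p - z)‖ < 1 / (n + 1) :=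
        hc.continuousAt.eventually_lt continuousAt_const (by simpa using hpos)
      have h1 : ∀ᶠ t in 𝓝[>] (0 : ℝ), t < 1 := by
        filter_upwards [Ioo_mem_nhdsGT (show (0 : ℝ) < 1 by norm_num)] with t ht using ht.2
      obtain ⟨t, ⟨h0, h1⟩, h2⟩ :=
        (((h0.filter_mono nhdsWithin_le_nhds).and h1).and self_mem_nhdsWithin).exists
      have h2 : 0 < t := h2
      refine ⟨z + t • (p - z), ?_, fun hmem => hpU ?_, by simpa using h0⟩
      · exact hD.add_smul_sub_mem hzD hp ⟨h2.le, h1.le⟩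
      · have h3 : p - z ∈ U := by
          have h4 := U.sub_mem hmem hzU
          have h5 : z + t • (p - z) - e - (z - e) = t • (p - z) := by abel
          rw [h5] at h4
          exact (U.smul_mem_iff h2.ne').1 h4
        have := U.add_mem h3 hzU
        rwa [sub_add_sub_cancel] at this
    · exact ⟨z, hzD, hzU, by simpa using hpos⟩)
  refine ⟨fun i => (f (i + 1)).1, fun i => (hfR i).1, fun w hw δ hδ => ?_, ?_⟩
  · obtain ⟨m, hm⟩ := (TopologicalSpace.denseRange_denseSeq ↥D).exists_dist_lt ⟨w, hw⟩
      (half_pos hδ)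
    obtain ⟨N, hN⟩ := exists_nat_one_div_lt (half_pos hδ)
    refine ⟨Nat.pair m N, ?_⟩
    have h1 := (hfR (Nat.pair m N)).2.2.1
    rw [Nat.unpair_pair] at h1
    have h2 : (1 : ℝ) / ((Nat.pair m N : ℕ) + 1) ≤ 1 / (N + 1) := by
      gcongr
      exact Nat.right_le_pair m N
    rw [Subtype.dist_eq, dist_comm, dist_eq_norm] at hm
    calc _ ≤ ‖(f (Nat.pair m N + 1)).1 - q m‖ + ‖(q m : W) - w‖ :=
          norm_sub_le_norm_sub_add_norm_sub ..
      _ < δ := by linarith [show ‖(q m : W) - w‖ < δ / 2 from hm]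
  · have hU : ∀ n, ∀ i < n, (f (i + 1)).1 - e ∈ (f n).2 := fun n => by
      induction n with
      | zero => simp
      | succ n ih =>
        intro i hi
        rcases Nat.lt_succ_iff_lt_or_eq.1 hi with h | rfl
        · exact (hfR n).2.2.2.1 (ih i h)
        · exact (hfR i).2.2.2.2
    intro n
    induction n with
    | zero => simp
    | succ n ih =>
      intro d hd i hi
      rw [Finset.sum_range_succ] at hd
      have hdn : d n = 0 := by
        by_contra hne
        refine (hfR n).2.1 (((f n).2.smul_mem_iff hne).1 ?_)
        have h1 : ∑ i ∈ Finset.range n, d i • ((f (i + 1)).1 - e) ∈ (f n).2 :=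
          Submodule.sum_mem _ fun i hi =>
            Submodule.smul_mem _ _ (hU n i (Finset.mem_range.1 hi))
        rw [eq_neg_of_add_eq_zero_right hd]
        exact Submodule.neg_mem _ h1
      rcases Nat.lt_succ_iff_lt_or_eq.1 hi with h | rfl
      · rw [hdn, zero_smul, add_zero] at hd
        exact ih d hd i h
      · exact hdn

/-- This is the convex combination in which `e` carries the remaining weight. -/
theorem Convex.add_sum_smul_sub_mem {D : Set W} (hD : Convex ℝ D) {e : W} (he : e ∈ D)
    {y : ℕ → W} (hy : ∀ i, y i ∈ D) {c : ℕ → ℝ} (hc : ∀ i, 0 ≤ c i) {n : ℕ}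
    (hsum : ∑ i ∈ Finset.range n, c i ≤ 1) :
    e + ∑ i ∈ Finset.range n, c i • (y i - e) ∈ D := by
  have h := hD.sum_mem (t := Finset.range (n + 1))
    (w := fun i => Nat.casesOn i (1 - ∑ i ∈ Finset.range n, c i) c)
    (z := fun i => Nat.casesOn i e y)
    (by rintro (_ | i) _
        · exact sub_nonneg.2 hsum
        · exact hc i)
    (by rw [Finset.sum_range_succ']; simp)
    (by rintro (_ | i) _
        · exact he
        · exact hy i)
  rw [Finset.sum_range_succ'] at h
  change ∑ k ∈ Finset.range n, c k • y k + (1 - ∑ i ∈ Finset.range n, c i) • e ∈ D at h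
  convert h using 1
  simp only [smul_sub, Finset.sum_sub_distrib, ← Finset.sum_smul, sub_smul, one_smul]
  abel

variable [HasConvexBalls W]

theorem summable_smul_of_abs_le_one [CompleteSpace W] {w : ℕ → W}
    (hw : ∀ i, ‖w i‖ ≤ (1 / 2) ^ i) {d : ℕ → ℝ} (hd : ∀ i, |d i| ≤ 1) :
    Summable fun i => d i • w i :=
  Summable.of_norm_bounded summable_geometric_two fun i =>
    (HasConvexBalls.norm_smul_le (hd i) _).trans (hw i)

/-- A linearly independent sequence seen from `e` can be rescaled such that it spans an infinite
cube inside the convex `G_δ`-set `D`, with uniquely determined bounded coordinates. -/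
theorem exists_cube [ContinuousSMul ℝ W] [CompleteSpace W]
    {D : Set W} (hD : Convex ℝ D) {O : ℕ → Set W} (hO : ∀ n, IsOpen (O n)) (hDO : D = ⋂ n, O n)
    {e : W} (he : e ∈ D) {y : ℕ → W} (hy : ∀ i, y i ∈ D)
    (hind : ∀ n (d : ℕ → ℝ), ∑ i ∈ Finset.range n, d i • (y i - e) = 0 → ∀ i < n, d i = 0) :
    ∃ w : ℕ → W, (∀ i, ∃ σ : ℝ, 0 < σ ∧ w i = σ • (y i - e)) ∧ (∀ i, ‖w i‖ ≤ (1 / 2) ^ i) ∧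
      (∀ a : ℕ → ℝ, (∀ i, a i ∈ Icc (0 : ℝ) 1) → e + ∑' i, a i • w i ∈ D) ∧
      ∀ d : ℕ → ℝ, (∀ i, |d i| ≤ 1) → ∑' i, d i • w i = 0 → d = 0 := by
  -- With scales at most `(1 / 2) ^ (i + 1)` the coefficients sum to at most 1, so every finite face
  -- of the cube consists of convex combinations of `e` and the `y i`.
  have hcubeD : ∀ (σ : ℕ → ℝ) (n : ℕ), (∀ i < n, 0 < σ i ∧ σ i ≤ (1 / 2) ^ (i + 1)) →
      ∀ a : ℕ → ℝ, (∀ i, a i ∈ Icc (0 : ℝ) 1) →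
      e + ∑ i ∈ Finset.range n, (a i * σ i) • (y i - e) ∈ D := by
    intro σ n hσ a ha
    have hle : ∀ i ∈ Finset.range n, a i * σ i ≤ (1 / 2) ^ (i + 1) := fun i hi => by
      have := hσ i (Finset.mem_range.1 hi)
      nlinarith [(ha i).1, (ha i).2]
    have h := hD.add_sum_smul_sub_mem he hy (c := fun i => if i < n then a i * σ i else 0)
      (fun i => by
        split_ifs with hi
        · exact mul_nonneg (ha i).1 (hσ i hi).1.le
        · exact le_rfl) (n := n) (by
      calc _ ≤ ∑ i ∈ Finset.range n, ((1 : ℝ) / 2) ^ (i + 1) := Finset.sum_le_sum fun i hi => by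
              rw [if_pos (Finset.mem_range.1 hi)]; exact hle i hi
        _ = (1 / 2) * ∑ i ∈ Finset.range n, ((1 : ℝ) / 2) ^ i := by
              rw [Finset.mul_sum]; exact Finset.sum_congr rfl fun i _ => by ring
        _ ≤ (1 / 2) * 2 := by
              gcongr
              exact sum_geometric_two_le n
        _ = 1 := by norm_num)
    convert h using 2
    exact Finset.sum_congr rfl fun i hi => by rw [if_pos (Finset.mem_range.1 hi)]
  -- The state holds the scales and a bound for the whole remaining tail. Stage `n` secures, against
  -- every such tail, membership of the cube in `O n` and non-vanishing of combinations with a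
  -- coefficient of size at least `1 / (n + 1)` among the first `n + 1`.
  obtain ⟨f, hf0, hfI, hfR⟩ := exists_seq_of_step (S := (ℕ → ℝ) × ℝ)
    (fun n s => 0 < s.2 ∧ ∀ i < n, 0 < s.1 i ∧ s.1 i ≤ (1 / 2) ^ (i + 1))
    (fun n s s' => (∀ i < n, s'.1 i = s.1 i) ∧ ‖s'.1 n • (y n - e)‖ ≤ s.2 / 2 ∧
      s'.2 ≤ s.2 / 2 ∧
      (∀ a : ℕ → ℝ, (∀ i, a i ∈ Icc (0 : ℝ) 1) → ∀ v,
        ‖v - (e + ∑ i ∈ Finset.range (n + 1), (a i * s'.1 i) • (y i - e))‖ ≤ s'.2 → v ∈ O n) ∧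
      ∀ d : ℕ → ℝ, (∀ i, |d i| ≤ 1) → (∃ i < n + 1, 1 ≤ (n + 1) * |d i|) → ∀ v,
        ‖v - ∑ i ∈ Finset.range (n + 1), (d i * s'.1 i) • (y i - e)‖ ≤ s'.2 → v ≠ 0)
    (s₀ := (fun _ => 1, 1)) ⟨one_pos, fun i hi => absurd hi (Nat.not_lt_zero i)⟩ (by
    rintro n ⟨σ, β⟩ ⟨hβ, hσ⟩
    have hβ : 0 < β := hβ
    obtain ⟨t, ⟨ht0, ht1⟩, ht2⟩ : ∃ t : ℝ, (0 < t ∧ t ≤ (1 / 2) ^ (n + 1)) ∧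
        ‖t • (y n - e)‖ ≤ β / 2 := by
      have hc : Continuous fun t : ℝ => ‖t • (y n - e)‖ := by fun_prop
      have h0 : ∀ᶠ t in 𝓝 (0 : ℝ), ‖t • (y n - e)‖ < β / 2 :=
        hc.continuousAt.eventually_lt continuousAt_const (by simpa using hβ)
      have h1 : ∀ᶠ t in 𝓝[>] (0 : ℝ), 0 < t ∧ t ≤ (1 / 2) ^ (n + 1) := by
        filter_upwards [Ioo_mem_nhdsGT (show (0 : ℝ) < (1 / 2) ^ (n + 1) by positivity)] with t ht
          using ⟨ht.1, ht.2.le⟩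
      obtain ⟨t, ht⟩ := (h1.and (h0.filter_mono nhdsWithin_le_nhds)).exists
      exact ⟨t, ht.1, ht.2.le⟩
    set σ' : ℕ → ℝ := Function.update σ n t with hσ'
    have hpre : ∀ i < n, σ' i = σ i := fun i hi => Function.update_of_ne hi.ne _ _
    have hn : σ' n = t := Function.update_self ..
    have hσ'I : ∀ i < n + 1, 0 < σ' i ∧ σ' i ≤ (1 / 2) ^ (i + 1) := fun i hi => by
      rcases Nat.lt_succ_iff_lt_or_eq.1 hi with h | rfl
      · rw [hpre i h]; exact hσ i h
      · rw [hn]; exact ⟨ht0, ht1⟩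
    have hcont : Continuous fun a : ℕ → ℝ =>
        ∑ i ∈ Finset.range (n + 1), (a i * σ' i) • (y i - e) := by fun_prop
    obtain ⟨δ₁, hδ₁, hm₁⟩ := (isCompact_univ_pi fun _ : ℕ =>
      (isCompact_Icc : IsCompact (Icc (0 : ℝ) 1))).exists_margin
      (continuous_const.add hcont : Continuous fun a : ℕ → ℝ => e + _).continuousOn (hO n)
      (fun a ha => by
        have := hcubeD σ' (n + 1) hσ'I a fun i => ha i (mem_univ i)
        rw [hDO] at this
        exact mem_iInter.1 this n)
    -- Coefficient vectors with one early coordinate bounded away from 0 form a compact set, and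
    -- linear independence keeps its image off 0. This makes independence robust enough to pass to
    -- infinite sums.
    have hL : IsCompact ((Set.univ.pi fun _ : ℕ => Icc (-1 : ℝ) 1) ∩
        ⋃ i ∈ Finset.range (n + 1), {d : ℕ → ℝ | 1 ≤ (n + 1) * |d i|}) := by
      refine (isCompact_univ_pi fun _ => isCompact_Icc).inter_right ?_
      refine isClosed_biUnion_finset fun i _ => isClosed_le continuous_const ?_
      fun_prop
    obtain ⟨δ₂, hδ₂, hm₂⟩ := hL.exists_margin hcont.continuousOn
      (isOpen_compl_singleton (x := (0 : W))) (by
        rintro d ⟨-, hd⟩ h0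
        simp only [mem_iUnion, Finset.mem_range, exists_prop] at hd
        obtain ⟨i, hi, hdi⟩ := hd
        have h1 := hind (n + 1) (fun i => d i * σ' i) h0 i hi
        have h2 : d i = 0 := (mul_eq_zero.1 h1).resolve_right (hσ'I i hi).1.ne'
        have hdi : 1 ≤ ((n : ℝ) + 1) * |d i| := hdi
        rw [h2, abs_zero, mul_zero] at hdi
        linarith)
    refine ⟨(σ', min (β / 2) (min δ₁ δ₂ / 2)), ⟨by positivity, hσ'I⟩, hpre, by simpa only [hn] using ht2,
      min_le_left _ _, fun a ha v hv => ?_, fun d hd hdi v hv => ?_⟩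
    · refine hm₁ a (fun i _ => ha i) v (hv.trans_lt ?_)
      have : min δ₁ δ₂ ≤ δ₁ := min_le_left _ _
      have : 0 < min δ₁ δ₂ := by positivity
      calc min (β / 2) (min δ₁ δ₂ / 2) ≤ min δ₁ δ₂ / 2 := min_le_right _ _
        _ < δ₁ := by linarith
    · refine hm₂ d ⟨fun i _ => abs_le.1 (hd i), ?_⟩ v (hv.trans_lt ?_)
      · obtain ⟨i, hi, h⟩ := hdi
        simp only [mem_iUnion, Finset.mem_range, exists_prop]
        exact ⟨i, hi, h⟩
      have : min δ₁ δ₂ ≤ δ₂ := min_le_right _ _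
      have : 0 < min δ₁ δ₂ := by positivity
      calc min (β / 2) (min δ₁ δ₂ / 2) ≤ min δ₁ δ₂ / 2 := min_le_right _ _
        _ < δ₂ := by linarith)
  set τ : ℕ → ℝ := fun i => (f (i + 1)).1 i with hτ
  set w : ℕ → W := fun i => τ i • (y i - e) with hw
  have hpre : ∀ n, ∀ i < n, (f n).1 i = τ i := fun n => by
    induction n with
    | zero => simp
    | succ n ih =>
      intro i hi
      rcases Nat.lt_succ_iff_lt_or_eq.1 hi with h | rfl
      · rw [(hfR n).1 i h, ih i h]
      · rfl
  have hβ : ∀ n k, (f (n + k)).2 ≤ (f n).2 * (1 / 2) ^ k := fun n k => by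
    induction k with
    | zero => simp
    | succ k ih =>
      have := (hfR (n + k)).2.2.1
      calc (f (n + (k + 1))).2 ≤ (f (n + k)).2 / 2 := this
        _ ≤ (f n).2 * (1 / 2) ^ (k + 1) := by rw [pow_succ]; linarith
  have hwn : ∀ n k, ‖w (n + k)‖ ≤ (f n).2 * (1 / 2) ^ k / 2 := fun n k =>
    (hfR (n + k)).2.1.trans (by linarith [hβ n k])
  have hwb : ∀ i, ‖w i‖ ≤ (1 / 2) ^ i := fun i => by
    have h1 := hwn 0 i
    rw [hf0, zero_add] at h1
    have : (0 : ℝ) < (1 / 2) ^ i := by positivity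
    simp only [one_mul] at h1
    linarith
  have htail : ∀ n (d : ℕ → ℝ), (∀ i, |d i| ≤ 1) →
      ‖∑' i, d i • w i - ∑ i ∈ Finset.range n, (d i * (f n).1 i) • (y i - e)‖ ≤ (f n).2 := by
    intro n d hd
    have h1 := (summable_smul_of_abs_le_one hwb hd).sum_add_tsum_nat_add n
    have h2 : ∑ i ∈ Finset.range n, (d i * (f n).1 i) • (y i - e)
        = ∑ i ∈ Finset.range n, d i • w i :=
      Finset.sum_congr rfl fun i hi => by rw [hpre n i (Finset.mem_range.1 hi), hw, smul_smul]
    rw [h2, ← h1, add_sub_cancel_left]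
    have h3 : HasSum (fun k : ℕ => (f n).2 / 2 * (1 / 2) ^ k) ((f n).2 / 2 * 2) :=
      hasSum_geometric_two.mul_left _
    rw [div_mul_cancel₀ _ (two_ne_zero)] at h3
    refine tsum_of_norm_bounded h3 fun k => (HasConvexBalls.norm_smul_le (hd _) _).trans ?_
    rw [add_comm k n]
    exact (hwn n k).trans (le_of_eq (by ring))
  refine ⟨w, fun i => ⟨τ i, ((hfI (i + 1)).2 i (Nat.lt_succ_self i)).1, rfl⟩, hwb,
    fun a ha => ?_, fun d hd h0 => ?_⟩
  · rw [hDO]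
    refine mem_iInter.2 fun n => (hfR n).2.2.2.1 a ha _ ?_
    rw [add_sub_add_left_eq_sub]
    exact htail (n + 1) a fun i => abs_le.2 ⟨by linarith [(ha i).1], (ha i).2⟩
  · funext i
    by_contra hne
    have hpos : 0 < |d i| := abs_pos.2 hne
    obtain ⟨N, hN⟩ := exists_nat_ge (1 / |d i|)
    refine (hfR (max N i)).2.2.2.2 d hd ⟨i, Nat.lt_succ_of_le (le_max_right _ _), ?_⟩ _
      (htail (max N i + 1) d hd) h0
    rw [div_le_iff₀ hpos] at hN
    have : (N : ℝ) ≤ (max N i : ℕ) := by exact_mod_cast le_max_left N i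
    nlinarith


/-- Over a compact metrizable space there is a family of pairwise disjoint convex subsets of the
infinite-dimensional convex `G_δ`-set `D`, with continuous sections near every point of `D`. -/
theorem exists_disjoint_isDenseFamily [ContinuousSMul ℝ W] [CompleteSpace W]
    [SecondCountableTopology W]
    {D : Set W} (hD : Convex ℝ D) {O : ℕ → Set W} (hO : ∀ n, IsOpen (O n)) (hDO : D = ⋂ n, O n)
    {e : W} (he : e ∈ D)
    (hinf : ∀ U : Submodule ℝ W, FiniteDimensional ℝ U → ∃ p ∈ D, p - e ∉ U)
    (K : Type w) [TopologicalSpace K] [CompactSpace K] [TopologicalSpace.MetrizableSpace K] :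
    ∃ T : K → Set W, IsDenseFamily D T ∧ ∀ x x' f, f ∈ T x → f ∈ T x' → x = x' := by
  obtain ⟨y, hy, hydense, hind⟩ := exists_dense_independent_seq hD he hinf
  obtain ⟨w, hwy, hwb, hcube, hinj⟩ := exists_cube hD hO hDO he hy hind
  let _ := TopologicalSpace.metrizableSpaceMetric K
  obtain ⟨F, hF⟩ := Metric.PiNatEmbed.exists_embedding_to_hilbert_cube (X := K)
  -- The coordinates of `x` in the Hilbert cube, preceded by a constant 1 that will recover the
  -- weight `η`.
  set b : K → ℕ → ℝ := fun x i => Nat.casesOn i 1 fun i => (F x i : ℝ) with hb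
  have hb01 : ∀ x i, b x i ∈ Icc (0 : ℝ) 1 := by
    rintro x (_ | i)
    · exact ⟨zero_le_one, le_rfl⟩
    · exact (F x i).2
  have hbc : ∀ i, Continuous fun x => b x i := by
    rintro (_ | i)
    · exact continuous_const
    · exact continuous_subtype_val.comp ((continuous_apply i).comp hF.continuous)
  -- Each coordinate of `x` is repeated infinitely often, so that it can be read off from any tail
  -- of the series.
  set a : K → ℕ → ℝ := fun x m => b x (Nat.unpair m).1 with ha
  have ha1 : ∀ x i, |a x i| ≤ 1 := fun x i =>
    abs_le.2 ⟨by linarith [(hb01 x (Nat.unpair i).1).1], (hb01 x _).2⟩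
  set h : K → W := fun x => e + ∑' i, a x i • w i with hh
  have hhc : Continuous h := by
    refine continuous_const.add (continuous_tsum (fun i => ?_) summable_geometric_two fun i x =>
      (HasConvexBalls.norm_smul_le (ha1 x i) _).trans (hwb i))
    exact (hbc _).smul continuous_const
  have hhD : ∀ x, h x ∈ D := fun x => hcube _ fun i => hb01 x _
  set D₀ : Set W := {v | v ∈ D ∧ v - e ∈ Submodule.span ℝ (range w)} with hD₀
  have hD₀c : Convex ℝ D₀ := by
    rintro v ⟨hv, hv'⟩ v' ⟨hv₁, hv₁'⟩ s t hs ht hst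
    refine ⟨hD hv hv₁ hs ht hst, ?_⟩
    have : s • v + t • v' - e = s • (v - e) + t • (v' - e) := by
      have h1 : e = (s + t) • e := by rw [hst, one_smul]
      conv_lhs => rw [h1]
      rw [add_smul, smul_sub, smul_sub]; abel
    rw [this]
    exact Submodule.add_mem _ (Submodule.smul_mem _ _ hv') (Submodule.smul_mem _ _ hv₁')
  have hyD₀ : ∀ i, y i ∈ D₀ := fun i => by
    obtain ⟨σ, hσ, hwi⟩ := hwy i
    refine ⟨hy i, ?_⟩
    rw [← Submodule.smul_mem_iff _ hσ.ne', ← hwi]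
    exact Submodule.subset_span ⟨i, rfl⟩
  -- A positive multiple of the marker `h x` is mixed into points with finitely many coordinates.
  -- Small `η` gives density, while `η > 0` lets the tail remember `x`.
  refine ⟨fun x => {f | ∃ v ∈ D₀, ∃ η ∈ Ioc (0 : ℝ) 1, f = (1 - η) • v + η • h x},
    ⟨fun x => ?_, fun x => ?_, fun z hz δ hδ => ?_⟩, ?_⟩
  · rintro _ ⟨v, hv, η, hη, rfl⟩ _ ⟨v', hv', η', hη', rfl⟩ s t hs ht hst
    have hpos : 0 < s * η + t * η' := by
      rcases hs.eq_or_lt with rfl | hs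
      · rw [zero_add] at hst; rw [hst]; linarith [hη'.1]
      · have := mul_pos hs hη.1
        have := mul_nonneg ht hη'.1.le
        linarith
    have hle : s * η + t * η' ≤ 1 := by nlinarith [hη.2, hη'.2]
    -- If the total weight of `h x` is 1, the part in `D₀` has weight 0 and cannot be renormalized;
    -- any point of `D₀` then serves.
    rcases hle.eq_or_lt with h1 | h1
    · refine ⟨v, hv, 1, ⟨one_pos, le_rfl⟩, ?_⟩
      have e1 : s * (1 - η) = 0 := by nlinarith [mul_nonneg hs (sub_nonneg.2 hη.2), mul_nonneg ht (sub_nonneg.2 hη'.2)]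
      have e2 : t * (1 - η') = 0 := by nlinarith [mul_nonneg hs (sub_nonneg.2 hη.2), mul_nonneg ht (sub_nonneg.2 hη'.2)]
      simp only [smul_add, smul_smul, e1, e2, zero_smul, zero_add, sub_self]
      rw [← add_smul, h1]
    · have hne : 1 - (s * η + t * η') ≠ 0 := by linarith
      have hpos' : 0 < 1 - (s * η + t * η') := by linarith
      refine ⟨(s * (1 - η) / (1 - (s * η + t * η'))) • v +
        (t * (1 - η') / (1 - (s * η + t * η'))) • v', hD₀c hv hv' ?_ ?_ ?_, s * η + t * η',
        ⟨hpos, hle⟩, ?_⟩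
      · exact div_nonneg (mul_nonneg hs (sub_nonneg.2 hη.2)) hpos'.le
      · exact div_nonneg (mul_nonneg ht (sub_nonneg.2 hη'.2)) hpos'.le
      · rw [← add_div, div_eq_one_iff_eq hne]; linear_combination hst
      · simp only [smul_add, smul_smul, mul_div_cancel₀ _ hne, add_smul]
        abel
  · rintro _ ⟨v, hv, η, hη, rfl⟩
    exact hD hv.1 (hhD x) (sub_nonneg.2 hη.2) hη.1.le (by ring)
  · obtain ⟨i, hi⟩ := hydense z hz (δ / 2) (half_pos hδ)
    have hcomp := isCompact_univ (X := K)
    obtain ⟨η, hη, hηs⟩ : ∃ η ∈ Ioc (0 : ℝ) 1, ∀ x, ‖η • (h x - y i)‖ < δ / 2 := by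
      have hc : Continuous fun p : ℝ × K => ‖p.1 • (h p.2 - y i)‖ := by fun_prop
      have hev : ∀ᶠ η in 𝓝 (0 : ℝ), ∀ x ∈ (univ : Set K), ‖η • (h x - y i)‖ < δ / 2 := by
        refine hcomp.eventually_forall_of_forall_eventually fun x _ => ?_
        refine hc.continuousAt.eventually_lt continuousAt_const ?_
        simpa using hδ
      have h1 : ∀ᶠ t in 𝓝[>] (0 : ℝ), t ∈ Ioo (0 : ℝ) 1 := Ioo_mem_nhdsGT one_pos
      obtain ⟨η, h1, h2⟩ := (h1.and (hev.filter_mono nhdsWithin_le_nhds)).exists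
      exact ⟨η, ⟨h1.1, h1.2.le⟩, fun x => h2 x (mem_univ x)⟩
    refine ⟨fun x => (1 - η) • y i + η • h x, by fun_prop, fun x => ⟨⟨y i, hyD₀ i, η, hη, rfl⟩, ?_⟩⟩
    have h1 : (1 - η) • y i + η • h x - z = η • (h x - y i) + (y i - z) := by
      rw [sub_smul, one_smul, smul_sub]; abel
    rw [h1]
    calc _ ≤ ‖η • (h x - y i)‖ + ‖y i - z‖ := norm_add_le _ _
      _ < δ / 2 + δ / 2 := add_lt_add (hηs x) hi
      _ = δ := by ring
  · rintro x x' _ ⟨v, hv, η, hη, rfl⟩ ⟨v', hv', η', hη', hff⟩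
    obtain ⟨c, hc⟩ := Finsupp.mem_span_range_iff_exists_finsupp.1 hv.2
    obtain ⟨c', hc'⟩ := Finsupp.mem_span_range_iff_exists_finsupp.1 hv'.2
    have hsum : ∀ c : ℕ →₀ ℝ, HasSum (fun i => c i • w i) (c.sum fun i s => s • w i) := fun c =>
      hasSum_sum_of_ne_finset_zero fun i hi => by
        rw [Finsupp.notMem_support_iff.1 hi, zero_smul]
    have hsa : ∀ x, HasSum (fun i => a x i • w i) (h x - e) := fun x => by
      rw [hh, add_sub_cancel_left]
      exact (summable_smul_of_abs_le_one hwb (ha1 x)).hasSum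
    set B : ℕ → ℝ := fun i => ((1 - η) * c i + η * a x i) - ((1 - η') * c' i + η' * a x' i) with hB
    have hB0 : HasSum (fun i => B i • w i) 0 := by
      have h1 := (((hsum c).const_smul (1 - η)).add ((hsa x).const_smul η)).sub
        (((hsum c').const_smul (1 - η')).add ((hsa x').const_smul η'))
      rw [hc, hc'] at h1
      convert h1 using 1
      · funext i
        simp only [hB, sub_smul, add_smul, mul_smul]
      · have h2 : ∀ (η : ℝ) (v h : W), (1 - η) • (v - e) + η • (h - e)
            = (1 - η) • v + η • h - e := fun η v h => by
          simp only [smul_sub, sub_smul, one_smul]; abel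
        rw [h2, h2, hff, sub_self]
    have hcb : ∀ c : ℕ →₀ ℝ, ∃ M : ℝ, ∀ i, |c i| ≤ M := fun c =>
      ⟨∑ j ∈ c.support, |c j|, fun i => by
        by_cases hi : i ∈ c.support
        · exact Finset.single_le_sum (f := fun j => |c j|) (fun j _ => abs_nonneg _) hi
        · rw [Finsupp.notMem_support_iff.1 hi, abs_zero]
          exact Finset.sum_nonneg fun j _ => abs_nonneg _⟩
    obtain ⟨M, hM⟩ := hcb c
    obtain ⟨M', hM'⟩ := hcb c'
    have hM0 : 0 ≤ M := (abs_nonneg _).trans (hM 0)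
    have hM0' : 0 ≤ M' := (abs_nonneg _).trans (hM' 0)
    have hBb : ∀ i, |B i| ≤ M + M' + 2 := fun i => by
      have h1 : |(1 - η) * c i| ≤ M := by
        rw [abs_mul]
        have : |1 - η| ≤ 1 := abs_le.2 ⟨by linarith [hη.2], by linarith [hη.1]⟩
        nlinarith [hM i, abs_nonneg (c i)]
      have h2 : |(1 - η') * c' i| ≤ M' := by
        rw [abs_mul]
        have : |1 - η'| ≤ 1 := abs_le.2 ⟨by linarith [hη'.2], by linarith [hη'.1]⟩
        nlinarith [hM' i, abs_nonneg (c' i)]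
      have h3 : |η * a x i| ≤ 1 := by
        rw [abs_mul, abs_of_pos hη.1]; nlinarith [ha1 x i, hη.1, hη.2, abs_nonneg (a x i)]
      have h4 : |η' * a x' i| ≤ 1 := by
        rw [abs_mul, abs_of_pos hη'.1]; nlinarith [ha1 x' i, hη'.1, hη'.2, abs_nonneg (a x' i)]
      rw [abs_le] at *
      constructor <;> simp only [hB] <;> linarith [h1.1, h1.2, h2.1, h2.2, h3.1, h3.2, h4.1, h4.2]
    -- Uniqueness of coordinates is known for coefficients in `[-1, 1]` only, hence the rescaling.
    have hpos : 0 < M + M' + 2 := by linarith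
    have hB' := hinj (fun i => (M + M' + 2)⁻¹ * B i) (fun i => by
      rw [abs_mul, abs_of_pos (inv_pos.2 hpos), inv_mul_le_iff₀ hpos, mul_one]
      exact hBb i) (by
      have h1 := hB0.const_smul (M + M' + 2)⁻¹
      rw [smul_zero] at h1
      simp only [smul_smul] at h1
      exact h1.tsum_eq)
    have hBz : ∀ i, B i = 0 := fun i =>
      (mul_eq_zero.1 (congrFun hB' i)).resolve_left (inv_pos.2 hpos).ne'
    -- Choose a repetition of the coordinate `i` beyond the finite supports of `c` and `c'`. The
    -- case `i = 0` then gives `η = η'`.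
    have hbb : ∀ i, η * b x i = η' * b x' i := fun i => by
      obtain ⟨j, hj⟩ := Finset.exists_nat_subset_range (c.support ∪ c'.support)
      have h1 : Nat.pair i j ∉ c.support ∪ c'.support := fun hmem => by
        have := Finset.mem_range.1 (hj hmem)
        exact absurd (Nat.right_le_pair i j) (by omega)
      rw [Finset.mem_union, not_or, Finsupp.notMem_support_iff, Finsupp.notMem_support_iff] at h1
      have h2 := hBz (Nat.pair i j)
      simp only [hB, ha, h1.1, h1.2, Nat.unpair_pair, mul_zero, zero_add] at h2
      linarith
    have h0 : η = η' := by simpa [hb] using hbb 0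
    refine hF.injective (funext fun i => Subtype.ext ?_)
    have h1 := hbb (i + 1)
    rw [← h0] at h1
    exact mul_left_cancel₀ hη.1.ne' h1

end IndependentSequences

/-! ### Towers of complete spaces -/

theorem norm_sub_le_two_mul {G : Type*} [NormedAddCommGroup G] {q : ℕ → G} {ρ : ℕ → ℝ}
    (h0 : ∀ n, 0 ≤ ρ n) (hρ : ∀ n, ρ (n + 1) ≤ ρ n / 2) (hq : ∀ n, ‖q (n + 1) - q n‖ ≤ ρ n)
    {m M : ℕ} (hM : m ≤ M) : ‖q M - q m‖ ≤ 2 * ρ m := by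
  have h : ‖q M - q m‖ ≤ 2 * ρ m - 2 * ρ M := by
    induction M, hM using Nat.le_induction with
    | base => simp
    | succ M hM ih =>
      calc ‖q (M + 1) - q m‖ ≤ ‖q (M + 1) - q M‖ + ‖q M - q m‖ :=
            norm_sub_le_norm_sub_add_norm_sub ..
        _ ≤ ρ M + (2 * ρ m - 2 * ρ M) := add_le_add (hq M) ih
        _ ≤ _ := by linarith [hρ M]
  linarith [h0 M]

theorem exists_tendsto_of_halving {G : Type*} [NormedAddCommGroup G] [CompleteSpace G] {q : ℕ → G}
    {ρ : ℕ → ℝ} (h0 : ∀ n, 0 ≤ ρ n) (hρ : ∀ n, ρ (n + 1) ≤ ρ n / 2)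
    (hq : ∀ n, ‖q (n + 1) - q n‖ ≤ ρ n) :
    ∃ y, Tendsto q atTop (𝓝 y) ∧ ∀ m, ‖y - q m‖ ≤ 2 * ρ m := by
  have hle : ∀ n, ρ n ≤ ρ 0 * (1 / 2) ^ n := fun n => by
    induction n with
    | zero => simp
    | succ n ih => rw [pow_succ]; linarith [hρ n]
  have hc : CauchySeq q := cauchySeq_of_le_geometric (1 / 2) (ρ 0) (by norm_num) fun n => by
    rw [dist_comm, dist_eq_norm]; exact (hq n).trans (hle n)
  obtain ⟨y, hy⟩ := cauchySeq_tendsto_of_complete hc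
  refine ⟨y, hy, fun m => le_of_tendsto (hy.sub_const (q m)).norm ?_⟩
  filter_upwards [eventually_ge_atTop m] with M hM using norm_sub_le_two_mul h0 hρ hq hM

/-- Iterated midpoints. It keeps the truncations of the series for $g(x)$ inside the convex set
attached to $x$. -/
theorem Convex.sum_halving_mem {W : Type*} [AddCommGroup W] [Module ℝ W] {S : Set W}
    (hS : Convex ℝ S) {z : W} (hz : z ∈ S) (n : ℕ) {y : ℕ → W} (hy : ∀ k, y k ∈ S) :
    ∑ k ∈ Finset.range n, (1 / 2 : ℝ) ^ (k + 1) • y k + (1 / 2 : ℝ) ^ n • z ∈ S := by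
  induction n generalizing y with
  | zero => simpa using hz
  | succ n ih =>
    have h := hS (hy 0) (ih fun k => hy (k + 1)) (a := 1 / 2) (b := 1 / 2) (by norm_num)
      (by norm_num) (by norm_num)
    convert h using 1
    rw [Finset.sum_range_succ', smul_add, Finset.smul_sum]
    simp only [smul_smul, ← pow_succ', zero_add, pow_one]
    abel

/-- The geometric tail of the constant value `z` is absorbed in the last term. Sums truncated at
different stages can thus be compared term by term. -/
theorem sum_halving_eq {W : Type*} [AddCommGroup W] [Module ℝ W] {y : ℕ → W} {z : W} {n : ℕ}
    (hy : ∀ k ≥ n, y k = z) {M : ℕ} (hM : n ≤ M) :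
    ∑ k ∈ Finset.range M, (1 / 2 : ℝ) ^ (k + 1) • y k + (1 / 2 : ℝ) ^ M • z =
      ∑ k ∈ Finset.range n, (1 / 2 : ℝ) ^ (k + 1) • y k + (1 / 2 : ℝ) ^ n • z := by
  induction M, hM using Nat.le_induction with
  | base => rfl
  | succ M hM ih =>
    rw [← ih, Finset.sum_range_succ, hy M hM, add_assoc, ← add_smul]
    congr 2
    ring

theorem norm_sum_halving_le {W : Type*} [NormedAddCommGroup W] [Module ℝ W] [HasConvexBalls W]
    {ε : ℝ} (n : ℕ) {y : ℕ → W} (hy : ∀ k, ‖y k‖ ≤ ε) :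
    ‖∑ k ∈ Finset.range n, (1 / 2 : ℝ) ^ (k + 1) • y k‖ ≤ ε := by
  have h := (HasConvexBalls.convex_closedBall_zero (G := W) ε).sum_halving_mem (z := 0)
    (by simpa using (norm_nonneg _).trans (hy 0)) n (y := y) (fun k => by simpa using hy k)
  simpa using h

/-- A continuous function that is positive on the open set `N` and bounds the distance to its
complement. -/
theorem IsOpen.exists_continuous_radius {G : Type*} [NormedAddCommGroup G] {N : Set G}
    (hN : IsOpen N) : ∃ d : G → ℝ, Continuous d ∧ (∀ v, 0 ≤ d v) ∧ (∀ v ∈ N, 0 < d v) ∧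
      ∀ v v', ‖v' - v‖ < d v → v' ∈ N := by
  rcases (Nᶜ).eq_empty_or_nonempty with h | h
  · rw [compl_empty_iff] at h
    exact ⟨fun _ => 1, continuous_const, fun _ => zero_le_one, fun _ _ => one_pos,
      fun _ _ _ => h ▸ mem_univ _⟩
  · refine ⟨fun v => Metric.infDist v Nᶜ, Metric.continuous_infDist_pt _,
      fun v => Metric.infDist_nonneg, fun v hv =>
        (hN.isClosed_compl.notMem_iff_infDist_pos h).1 (by simpa using hv), fun v v' hv => ?_⟩
    have := Metric.notMem_of_dist_lt_infDist (s := Nᶜ) (x := v) (y := v')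
      (by rwa [dist_comm, dist_eq_norm])
    simpa using this

theorem exists_pos_le_of_finite (δ : ℕ → ℝ) (hδ : ∀ k, 0 < δ k) (n : ℕ) :
    ∃ ε > 0, ∀ k < n, ε ≤ δ k := by
  induction n with
  | zero => exact ⟨1, one_pos, by simp⟩
  | succ n ih =>
    obtain ⟨ε, hε, h⟩ := ih
    refine ⟨min ε (δ n), lt_min hε (hδ n), fun k hk => ?_⟩
    rcases Nat.lt_succ_iff_lt_or_eq.1 hk with h' | rfl
    · exact (min_le_left _ _).trans (h k h')
    · exact min_le_right _ _

/-! ### Abstract towers and their disjoint families -/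

section

variable (W : Type u) [NormedAddCommGroup W] [Module ℝ W]
  (G : ℕ → Type u) [∀ k, NormedAddCommGroup (G k)] [∀ k, Module ℝ (G k)]

/-- A decreasing sequence of spaces `G k` inside `G 0` with intersection `W`, a convex set `C` in
`G 0` that is the intersection of the open sets `O n`, and for each `k` open sets `U k j` whose
complements are `Z`-sets in `C ∩ G k` that cover `C ∩ G (k + 1)`. -/
structure SpaceTower where
  ι : ∀ k, W →ₗ[ℝ] G k
  J : ∀ k, G k →ₗ[ℝ] G 0
  norm_ι_le : ∀ k w, ‖ι k w‖ ≤ ‖w‖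
  norm_ι_mono : ∀ {k k'}, k ≤ k' → ∀ w, ‖ι k w‖ ≤ ‖ι k' w‖
  norm_J_le : ∀ k f, ‖J k f‖ ≤ ‖f‖
  J_ι : ∀ k w, J k (ι k w) = ι 0 w
  J_zero : ∀ f, J 0 f = f
  ι_injective : Function.Injective (ι 0)
  mem_range_ι : ∀ z, (∀ k, z ∈ range (J k)) → z ∈ range (ι 0)
  C : Set (G 0)
  convex_C : Convex ℝ C
  nonempty_C : C.Nonempty
  O : ℕ → Set (G 0)
  isOpen_O : ∀ n, IsOpen (O n)
  C_eq : C = ⋂ n, O n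
  dense : ∀ k f, J k f ∈ C → f ∈ closure (ι k '' {w | ι 0 w ∈ C})
  U : ∀ k, ℕ → Set (G k)
  isOpen_U : ∀ k j, IsOpen (U k j)
  approxInto_U : ∀ k j, ApproxInto {f | J k f ∈ C} (U k j)
  exists_notMem_U : ∀ k f, J k f ∈ C → J k f ∈ range (J (k + 1)) → ∃ j, f ∉ U k j

end

namespace SpaceTower

variable {W : Type u} [NormedAddCommGroup W] [Module ℝ W]
  {G : ℕ → Type u} [∀ k, NormedAddCommGroup (G k)] [∀ k, Module ℝ (G k)]
  (τ : SpaceTower W G)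

theorem continuous_ι (k : ℕ) : Continuous (τ.ι k) :=
  AddMonoidHomClass.continuous_of_bound (τ.ι k) 1 fun w => by simpa using τ.norm_ι_le k w

theorem continuous_J (k : ℕ) : Continuous (τ.J k) :=
  AddMonoidHomClass.continuous_of_bound (τ.J k) 1 fun w => by simpa using τ.norm_J_le k w

theorem ι_mem_range_J (k : ℕ) (w : W) : τ.ι 0 w ∈ range (τ.J k) := ⟨τ.ι k w, τ.J_ι k w⟩

theorem convex_level (k : ℕ) : Convex ℝ {f | τ.J k f ∈ τ.C} :=
  τ.convex_C.linear_preimage (τ.J k)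

/-- Baire's theorem in the complete space `closure τ.C`: there `τ.C` is a dense $G_\delta$, and
approximating constant maps of the cube shows that each `τ.U 0 j` is dense. -/
theorem exists_mem_forall_mem_U [CompleteSpace (G 0)] : ∃ f ∈ τ.C, ∀ j, f ∈ τ.U 0 j := by
  have hC : {f | τ.J 0 f ∈ τ.C} = τ.C := by ext f; simp [τ.J_zero]
  have hUd : ∀ j, ∀ f ∈ τ.C, ∀ δ > 0, ∃ f' ∈ τ.C ∩ τ.U 0 j, dist f f' < δ := fun j f hf δ hδ => by
    obtain ⟨F', h1, h2⟩ := τ.approxInto_U 0 j (ContinuousMap.const _ f)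
      (fun _ => by rw [hC]; exact hf) δ hδ
    rw [hC] at h1
    refine ⟨F' 0, h1 0, ?_⟩
    rw [dist_comm, dist_eq_norm]
    exact h2 0
  have : CompleteSpace ↥(closure τ.C) := isClosed_closure.completeSpace_coe
  have hopen : ∀ N : Set (G 0), IsOpen N → (∀ f ∈ τ.C, ∀ δ > 0, ∃ f' ∈ τ.C ∩ N, dist f f' < δ) →
      IsOpen {x : ↥(closure τ.C) | (x : G 0) ∈ N} ∧ Dense {x : ↥(closure τ.C) | (x : G 0) ∈ N} := by
    intro N hN hd
    refine ⟨hN.preimage continuous_subtype_val, Metric.dense_iff.2 fun x δ hδ => ?_⟩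
    obtain ⟨f, hf, hxf⟩ := Metric.mem_closure_iff.1 x.2 (δ / 2) (half_pos hδ)
    obtain ⟨f', hf', hff⟩ := hd f hf (δ / 2) (half_pos hδ)
    refine ⟨⟨f', subset_closure hf'.1⟩, ?_, hf'.2⟩
    rw [Metric.mem_ball, dist_comm, Subtype.dist_eq]
    exact (dist_triangle _ f _).trans_lt (by linarith)
  have hO : ∀ n, ∀ f ∈ τ.C, ∀ δ > 0, ∃ f' ∈ τ.C ∩ τ.O n, dist f f' < δ := fun n f hf δ hδ =>
    ⟨f, ⟨hf, by rw [τ.C_eq] at hf; exact mem_iInter.1 hf n⟩, by simpa using hδ⟩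
  have h1 := dense_iInter_of_isOpen (fun n => (hopen _ (τ.isOpen_O n) (hO n)).1)
    (fun n => (hopen _ (τ.isOpen_O n) (hO n)).2)
  have h2 := dense_iInter_of_isOpen (fun n => (hopen _ (τ.isOpen_U 0 n) (hUd n)).1)
    (fun n => (hopen _ (τ.isOpen_U 0 n) (hUd n)).2)
  have h3 := h1.inter_of_Gδ (.iInter_of_isOpen fun n => (hopen _ (τ.isOpen_O n) (hO n)).1)
    (.iInter_of_isOpen fun n => (hopen _ (τ.isOpen_U 0 n) (hUd n)).1) h2
  have : Nonempty ↥(closure τ.C) := τ.nonempty_C.closure.to_subtype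
  obtain ⟨x, hx, hx'⟩ := h3.nonempty
  rw [mem_iInter] at hx hx'
  exact ⟨x, τ.C_eq.ge (mem_iInter.2 hx), hx'⟩

/-- Otherwise the smooth points of `τ.C` lie in a translate of a finite-dimensional subspace, which
is closed at level 0. By density all of `τ.C` lies in it, hence is smooth and covered by the Z-sets
of level 0, against Baire's theorem. -/
theorem exists_sub_notMem [ContinuousSMul ℝ (G 0)] [CompleteSpace (G 0)] {e : W}
    (U : Submodule ℝ W) (hU : FiniteDimensional ℝ U) :
    ∃ p, τ.ι 0 p ∈ τ.C ∧ p - e ∉ U := by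
  by_contra! hcon
  obtain ⟨f, hf, hfU⟩ := τ.exists_mem_forall_mem_U
  have hcl : IsClosed ((U.map (τ.ι 0) : Submodule ℝ (G 0)) : Set (G 0)) :=
    Submodule.closed_of_finiteDimensional _
  have hcl' : IsClosed {f | f - τ.ι 0 e ∈ U.map (τ.ι 0)} :=
    hcl.preimage (continuous_id.sub continuous_const)
  have hmem := closure_minimal (t := {f | f - τ.ι 0 e ∈ U.map (τ.ι 0)}) (by
    rintro _ ⟨p, hp, rfl⟩
    exact ⟨p - e, hcon p hp, map_sub _ _ _⟩) hcl' (τ.dense 0 f (by rwa [τ.J_zero]))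
  obtain ⟨p, -, hp⟩ := hmem
  have h1 : f = τ.ι 0 (p + e) := by rw [map_add, hp, sub_add_cancel]
  obtain ⟨j, hj⟩ := τ.exists_notMem_U 0 f (by rwa [τ.J_zero])
    (by rw [τ.J_zero, h1]; exact τ.ι_mem_range_J 1 _)
  exact hj (hfU j)

theorem nonempty_smooth : ∃ e, τ.ι 0 e ∈ τ.C := by
  obtain ⟨f, hf⟩ := τ.nonempty_C
  obtain ⟨_, e, he, -⟩ := closure_nonempty_iff.1 ⟨f, τ.dense 0 f (by rwa [τ.J_zero])⟩
  exact ⟨e, he⟩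

/-- The disjoint family is built once, in `W`. Since smooth points are dense in `τ.C` at every level
and each `τ.ι k` is norm-nonincreasing, the same family is dense at all levels. -/
theorem exists_family [HasConvexBalls W] [ContinuousSMul ℝ W] [CompleteSpace W]
    [SecondCountableTopology W] [ContinuousSMul ℝ (G 0)] [CompleteSpace (G 0)]
    (K : Type w) [TopologicalSpace K] [CompactSpace K] [TopologicalSpace.MetrizableSpace K] :
    ∃ T : K → Set W, (∀ x, Convex ℝ (T x)) ∧ (∀ x, ∀ w ∈ T x, τ.ι 0 w ∈ τ.C) ∧
      (∀ k, IsDenseFamily {f | τ.J k f ∈ τ.C} fun x => τ.ι k '' T x) ∧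
      (∃ h : K → W, Continuous h ∧ ∀ x, h x ∈ T x) ∧
      ∀ x x' f, f ∈ T x → f ∈ T x' → x = x' := by
  obtain ⟨e, he⟩ := τ.nonempty_smooth
  obtain ⟨T, hT, hdisj⟩ := exists_disjoint_isDenseFamily (W := W) (D := {w | τ.ι 0 w ∈ τ.C})
    (τ.convex_C.linear_preimage (τ.ι 0)) (O := fun n => τ.ι 0 ⁻¹' τ.O n)
    (fun n => (τ.isOpen_O n).preimage (τ.continuous_ι 0))
    (by
      have h : τ.C = ⋂ n, τ.O n := τ.C_eq
      ext w
      rw [h]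
      simp [mem_iInter]) (e := e) he
    (fun U hU => τ.exists_sub_notMem U hU) K
  refine ⟨T, hT.convex, fun x w hw => hT.subset x hw, fun k => ⟨fun x => ?_, ?_, ?_⟩, ?_, hdisj⟩
  · exact (hT.convex x).linear_image (τ.ι k)
  · rintro x _ ⟨w, hw, rfl⟩
    show τ.J k (τ.ι k w) ∈ τ.C
    rw [τ.J_ι]
    exact hT.subset x hw
  · intro y hy δ hδ
    obtain ⟨_, ⟨w, hw, rfl⟩, hyw⟩ := Metric.mem_closure_iff.1 (τ.dense k y hy) (δ / 2) (half_pos hδ)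
    obtain ⟨s, hs, hsT⟩ := hT.exists_section w hw (δ / 2) (half_pos hδ)
    refine ⟨fun x => τ.ι k (s x), (τ.continuous_ι k).comp hs,
      fun x => ⟨mem_image_of_mem _ (hsT x).1, ?_⟩⟩
    rw [dist_comm, dist_eq_norm] at hyw
    calc ‖τ.ι k (s x) - y‖ ≤ ‖τ.ι k (s x) - τ.ι k w‖ + ‖τ.ι k w - y‖ :=
          norm_sub_le_norm_sub_add_norm_sub ..
      _ < δ / 2 + δ / 2 := by
          refine add_lt_add ?_ hyw
          rw [← map_sub]
          exact (τ.norm_ι_le k _).trans_lt (hsT x).2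
      _ = δ := by ring
  · obtain ⟨s, hs, hsT⟩ := hT.exists_section e he 1 one_pos
    exact ⟨s, hs, fun x => (hsT x).1⟩

end SpaceTower

/-- The sum `∑ k < n, 2⁻¹ ^ (k + 1) • y k + 2⁻¹ ^ n • z`. -/
noncomputable def halvingSum {W : Type*} [AddCommGroup W] [Module ℝ W] (y : ℕ → W) (z : W) (n : ℕ) : W :=
  ∑ k ∈ Finset.range n, (1 / 2 : ℝ) ^ (k + 1) • y k + (1 / 2 : ℝ) ^ n • z

/-! ### The inductive stages -/

namespace SpaceTower

variable {W : Type u} [NormedAddCommGroup W] [Module ℝ W]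
  {G : ℕ → Type u} [∀ k, NormedAddCommGroup (G k)] [∀ k, Module ℝ (G k)]
  [∀ k, ContinuousSMul ℝ (G k)] [∀ k, HasConvexBalls (G k)]
  (τ : SpaceTower W G)
  {K : Type w} [MetricSpace K] [CompactSpace K]

/-- The state of the construction after `i` steps: approximations `u k` of the map to level `k`,
and bounds `r k` for their future changes. -/
structure IsStage (T : K → Set W) (h : K → W) (φ : ℕ → ℕ → K → ℝ) (i : ℕ)
    (s : (ℕ → K → W) × (ℕ → K → ℝ)) : Prop where
  cont : ∀ k, Continuous fun x => τ.ι k (s.1 k x)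
  mem : ∀ k x, s.1 k x ∈ T x
  idle : ∀ k ≥ i, s.1 k = h
  cont_r : ∀ k, Continuous (s.2 k)
  r_nonneg : ∀ k x, 0 ≤ s.2 k x
  r_pos : ∀ k x, φ k i x ≠ 0 → 0 < s.2 k x
  r_zero : ∀ k x, φ k i x = 0 → s.2 k x = 0
  margin : ∃ ε > 0, (∀ k x, s.2 k x ≤ ε) ∧
    (∀ k x v, ‖v - τ.ι 0 (s.1 k x)‖ ≤ 2 * ε → v ∈ τ.O i) ∧
    (∀ x v, ‖v - τ.ι 0 (halvingSum (fun k => s.1 k x) (h x) i)‖ ≤ 2 * ε → v ∈ τ.O i) ∧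
    ∀ x y, (1 / 2 : ℝ) ^ i ≤ dist x y →
      4 * ε < ‖τ.ι 0 (halvingSum (fun k => s.1 k x) (h x) i) -
        τ.ι 0 (halvingSum (fun k => s.1 k y) (h y) i)‖
  avoid : ∀ k < i, ∀ j < i, ∀ x, φ k i x ≠ 0 →
    ∀ v, ‖v - τ.ι k (s.1 k x)‖ ≤ 2 * s.2 k x → v ∈ τ.U k j

variable {T : K → Set W} (hTc : ∀ x, Convex ℝ (T x)) (hTC : ∀ x, ∀ w ∈ T x, τ.ι 0 w ∈ τ.C)
  (hTf : ∀ k, IsDenseFamily {f | τ.J k f ∈ τ.C} fun x => τ.ι k '' T x)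
  {h : K → W} (hh : Continuous h) (hhT : ∀ x, h x ∈ T x)
  (hdisj : ∀ x x' f, f ∈ T x → f ∈ T x' → x = x')
  {φ : ℕ → ℕ → K → ℝ} (hφc : ∀ k i, Continuous (φ k i)) (hφ : ∀ k i x, φ k i x ∈ Icc (0 : ℝ) 1)
  (hφm : ∀ k i x, φ k i x = 0 → φ k (i + 1) x = 0)

omit [∀ k, HasConvexBalls (G k)] in
include hTc hTC hh hhT hdisj in
-- The halving sums at `x` and `y` lie in the disjoint sets `T x` and `T y`, so they differ; on the
-- compact set of pairs at distance at least `(1 / 2) ^ i` the difference is bounded below. Since `u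
-- k = h` for `k ≥ i`, only finitely many margins in `τ.O i` are needed.
theorem exists_margin_stage (i : ℕ) {u : ℕ → K → W} (hu : ∀ k, Continuous fun x => τ.ι k (u k x))
    (huT : ∀ k x, u k x ∈ T x) (hidle : ∀ k ≥ i, u k = h) :
    ∃ ε > 0, (∀ k x v, ‖v - τ.ι 0 (u k x)‖ ≤ 2 * ε → v ∈ τ.O i) ∧
    (∀ x v, ‖v - τ.ι 0 (halvingSum (fun k => u k x) (h x) i)‖ ≤ 2 * ε → v ∈ τ.O i) ∧
    ∀ x y, (1 / 2 : ℝ) ^ i ≤ dist x y →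
      4 * ε < ‖τ.ι 0 (halvingSum (fun k => u k x) (h x) i) -
        τ.ι 0 (halvingSum (fun k => u k y) (h y) i)‖ := by
  have hO : ∀ x, ∀ w ∈ T x, τ.ι 0 w ∈ τ.O i := fun x w hw => by
    have := hTC x w hw
    rw [τ.C_eq] at this
    exact mem_iInter.1 this i
  have hu0 : ∀ k, Continuous fun x => τ.ι 0 (u k x) := fun k => by
    simpa only [Function.comp_def, τ.J_ι] using (τ.continuous_J k).comp (hu k)
  have hPT : ∀ x, halvingSum (fun k => u k x) (h x) i ∈ T x := fun x =>
    (hTc x).sum_halving_mem (hhT x) i fun k => huT k x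
  have hP : Continuous fun x => τ.ι 0 (halvingSum (fun k => u k x) (h x) i) := by
    simp only [halvingSum, map_add, map_sum, map_smul]
    exact (continuous_finsetSum _ fun k _ => (hu0 k).const_smul _).add
      (((τ.continuous_ι 0).comp hh).const_smul _)
  have h1 : ∀ k, ∃ δ > 0, ∀ x ∈ (univ : Set K), ∀ v, ‖v - τ.ι 0 (u k x)‖ < δ → v ∈ τ.O i :=
    fun k => isCompact_univ.exists_margin (hu0 k).continuousOn (τ.isOpen_O i)
      fun x _ => hO x _ (huT k x)
  choose δ hδ hδO using h1
  obtain ⟨ε₁, hε₁, hε₁δ⟩ := exists_pos_le_of_finite δ hδ (i + 1)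
  obtain ⟨ε₂, hε₂, hε₂O⟩ := isCompact_univ.exists_margin hP.continuousOn (τ.isOpen_O i)
    fun x _ => hO x _ (hPT x)
  have hL : IsCompact {p : K × K | (1 / 2 : ℝ) ^ i ≤ dist p.1 p.2} :=
    (isClosed_le continuous_const (by fun_prop)).isCompact
  obtain ⟨ε₃, hε₃, hε₃O⟩ := hL.exists_margin
    ((hP.comp continuous_fst).sub (hP.comp continuous_snd)).continuousOn
    (isOpen_compl_singleton (x := (0 : G 0))) (by
      rintro ⟨x, y⟩ hxy h0
      have h2 := τ.ι_injective (sub_eq_zero.1 h0)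
      have h3 := hdisj x y _ (hPT x) (h2 ▸ hPT y)
      have hxy : (1 / 2 : ℝ) ^ i ≤ dist x y := hxy
      rw [h3, dist_self] at hxy
      have : (0 : ℝ) < (1 / 2) ^ i := by positivity
      linarith)
  -- Any divisor above 4 works: the conclusions need `2 * ε` and `4 * ε` strictly below the margins.
  set ε := min ε₁ (min ε₂ ε₃) / 5 with hε
  have hm : 0 < min ε₁ (min ε₂ ε₃) := by positivity
  have hl1 : 5 * ε ≤ ε₁ := by
    rw [hε, mul_div_cancel₀ _ (by norm_num)]; exact min_le_left _ _
  have hl2 : 5 * ε ≤ ε₂ := by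
    rw [hε, mul_div_cancel₀ _ (by norm_num)]; exact (min_le_right _ _).trans (min_le_left _ _)
  have hl3 : 5 * ε ≤ ε₃ := by
    rw [hε, mul_div_cancel₀ _ (by norm_num)]; exact (min_le_right _ _).trans (min_le_right _ _)
  have hε0 : 0 < ε := by positivity
  refine ⟨ε, hε0, fun k x v hv => ?_, fun x v hv => hε₂O x (mem_univ x) v (by linarith),
    fun x y hxy => ?_⟩
  · rcases le_total k i with hk | hk
    · exact hδO k x (mem_univ x) v (by linarith [hε₁δ k (by omega)])
    · rw [hidle k hk, ← hidle i le_rfl] at hv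
      exact hδO i x (mem_univ x) v (by linarith [hε₁δ i (by omega)])
  · by_contra! hcon
    refine hε₃O (x, y) hxy 0 ?_ rfl
    rw [zero_sub, norm_neg]
    exact hcon.trans_lt (by linarith)

include hTc hTC hTf hh hhT hdisj hφc hφ hφm in
-- For `k ≤ i` the approximation `u k` is pushed into the first `i + 1` sets `τ.U k j` wherever its
-- radius is positive; the new radii are then cut down so that no later change can undo this.
-- Continuity is controlled only in `G k`, although the values are in `W`.
theorem IsStage.exists_next {i : ℕ} {s : (ℕ → K → W) × (ℕ → K → ℝ)}
    (hs : τ.IsStage T h φ i s) : ∃ s', τ.IsStage T h φ (i + 1) s' ∧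
      ∀ k x, ‖τ.ι k (s'.1 k x - s.1 k x)‖ ≤ s.2 k x ∧ s'.2 k x ≤ s.2 k x / 2 := by
  set N : ∀ k, Set (G k) := fun k => ⋂ j < i + 1, τ.U k j with hN
  have hNop : ∀ k, IsOpen (N k) ∧ ApproxInto {f | τ.J k f ∈ τ.C} (N k) := fun k =>
    ApproxInto.biInter (τ.isOpen_U k) (τ.approxInto_U k) (i + 1)
  have h1 : ∀ k, ∃ u' : K → W, (Continuous fun x => τ.ι k (u' x)) ∧ (∀ x, u' x ∈ T x) ∧
      (∀ x, ‖τ.ι k (u' x - s.1 k x)‖ ≤ s.2 k x) ∧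
      (k ≤ i → ∀ x, 0 < s.2 k x → τ.ι k (u' x) ∈ N k) ∧ (i < k → u' = s.1 k) := fun k => by
    rcases le_or_gt k i with hk | hk
    · obtain ⟨g', hg', hg'T, hgg, hg'N⟩ := (hTf k).exists_perturbation (τ.convex_level k)
        (hNop k).1 (hNop k).2 (hs.cont k) (fun x => mem_image_of_mem _ (hs.mem k x))
        (hs.cont_r k) (hs.r_nonneg k)
      choose u' hu'T hu' using hg'T
      obtain rfl : (fun x => τ.ι k (u' x)) = g' := funext hu'
      exact ⟨u', hg', hu'T, fun x => by rw [map_sub]; exact hgg x, fun _ => hg'N,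
        fun h => absurd hk (not_le.2 h)⟩
    · exact ⟨s.1 k, hs.cont k, hs.mem k, fun x => by simpa using hs.r_nonneg k x,
        fun h => absurd hk (not_lt.2 h), fun _ => rfl⟩
  choose u' hu'c hu'T hu'r hu'N hu'i using h1
  have hidle : ∀ k ≥ i + 1, u' k = h := fun k hk => by
    rw [hu'i k (by omega), hs.idle k (by omega)]
  obtain ⟨ε, hε, hm1, hm2, hm3⟩ := τ.exists_margin_stage hTc hTC hh hhT hdisj (i + 1) hu'c hu'T hidle
  have h2 : ∀ k, ∃ d : K → ℝ, Continuous d ∧ (∀ x, 0 ≤ d x) ∧ (∀ x, 0 < s.2 k x → 0 < d x) ∧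
      (k ≤ i → ∀ x v, ‖v - τ.ι k (u' k x)‖ < d x → v ∈ N k) := fun k => by
    rcases le_or_gt k i with hk | hk
    · obtain ⟨d, hd, hd0, hdpos, hdN⟩ := (hNop k).1.exists_continuous_radius
      exact ⟨fun x => d (τ.ι k (u' k x)), hd.comp (hu'c k), fun x => hd0 _,
        fun x hx => hdpos _ (hu'N k hk x hx), fun _ x v hv => hdN _ v hv⟩
    · exact ⟨fun _ => 1, continuous_const, fun _ => zero_le_one, fun _ _ => one_pos,
        fun h => absurd hk (not_lt.2 h)⟩
  choose d hdc hd0 hdpos hdN using h2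
  -- Halving bounds all future changes by twice the radius; `ε` protects the margins at level 0; `d
  -- / 3` keeps the ball of doubled radius in `N k`. The factor `φ k (i + 1)` used below freezes the
  -- points where that function vanishes.
  set m : ℕ → K → ℝ := fun k x => min (min (s.2 k x / 2) ε) (d k x / 3) with hm
  have hm0 : ∀ k x, 0 ≤ m k x := fun k x =>
    le_min (le_min (div_nonneg (hs.r_nonneg k x) two_pos.le) hε.le)
      (div_nonneg (hd0 k x) (by norm_num))
  have hmle : ∀ k x, m k x * φ k (i + 1) x ≤ m k x := fun k x =>
    mul_le_of_le_one_right (hm0 k x) (hφ k (i + 1) x).2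
  have hpos : ∀ k x, φ k (i + 1) x ≠ 0 → 0 < s.2 k x := fun k x hx =>
    hs.r_pos k x fun h0 => hx (hφm k i x h0)
  refine ⟨(u', fun k x => m k x * φ k (i + 1) x), ⟨hu'c, hu'T, hidle, fun k => ?_, fun k x => ?_,
    fun k x hx => ?_, fun k x hx => ?_, ⟨ε, hε, fun k x => ?_, hm1, hm2, hm3⟩,
    fun k hk j hj x hx v hv => ?_⟩, fun k x => ⟨hu'r k x, ?_⟩⟩
  · exact ((((hs.cont_r k).div_const _).min continuous_const).min ((hdc k).div_const _)).mul
      (hφc k (i + 1))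
  · exact mul_nonneg (hm0 k x) (hφ k (i + 1) x).1
  · refine mul_pos (lt_min (lt_min (half_pos (hpos k x hx)) hε)
      (div_pos (hdpos k x (hpos k x hx)) (by norm_num))) ((hφ k (i + 1) x).1.lt_of_ne' hx)
  · show m k x * φ k (i + 1) x = 0
    rw [hx, mul_zero]
  · exact (hmle k x).trans ((min_le_left _ _).trans (min_le_right _ _))
  · have h3 : v ∈ N k := by
      refine hdN k (by omega) x v (hv.trans_lt ?_)
      have h4 := hdpos k x (hpos k x hx)
      have h5 := (hmle k x).trans (min_le_right _ _)
      calc 2 * (m k x * φ k (i + 1) x) ≤ 2 * (d k x / 3) := by gcongr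
        _ < d k x := by linarith
    exact mem_iInter₂.1 h3 j hj
  · exact (hmle k x).trans ((min_le_left _ _).trans (min_le_left _ _))

include hTc hTC hTf hh hhT hdisj hφc hφ hφm in
theorem exists_stages : ∃ s : ℕ → (ℕ → K → W) × (ℕ → K → ℝ), (∀ i, τ.IsStage T h φ i (s i)) ∧
    ∀ i k x, ‖τ.ι k ((s (i + 1)).1 k x - (s i).1 k x)‖ ≤ (s i).2 k x ∧
      (s (i + 1)).2 k x ≤ (s i).2 k x / 2 := by
  obtain ⟨ε, hε, hm⟩ := τ.exists_margin_stage hTc hTC hh hhT hdisj 0 (u := fun _ => h)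
    (fun k => (τ.continuous_ι k).comp hh) (fun _ => hhT) (fun _ _ => rfl)
  have h0 : τ.IsStage T h φ 0 (fun _ => h, fun k x => ε * φ k 0 x) :=
    ⟨fun k => (τ.continuous_ι k).comp hh, fun _ => hhT, fun _ _ => rfl,
      fun k => continuous_const.mul (hφc k 0), fun k x => mul_nonneg hε.le (hφ k 0 x).1,
      fun k x hx => mul_pos hε ((hφ k 0 x).1.lt_of_ne' hx),
      fun k x hx => by show ε * φ k 0 x = 0; rw [hx, mul_zero],
      ⟨ε, hε, fun k x => mul_le_of_le_one_right hε.le (hφ k 0 x).2, hm⟩,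
      fun k hk => absurd hk (Nat.not_lt_zero k)⟩
  obtain ⟨s, -, hs, hR⟩ := exists_seq_of_step _
    (fun _ s s' => ∀ k x, ‖τ.ι k (s'.1 k x - s.1 k x)‖ ≤ s.2 k x ∧ s'.2 k x ≤ s.2 k x / 2) h0
    (fun i s hs => hs.exists_next τ hTc hTC hTf hh hhT hdisj hφc hφ hφm)
  exact ⟨s, hs, hR⟩

end SpaceTower

/-! ### Passage to the limit -/

namespace SpaceTower

variable {W : Type u} [NormedAddCommGroup W] [Module ℝ W]
  {G : ℕ → Type u} [∀ k, NormedAddCommGroup (G k)] [∀ k, Module ℝ (G k)]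
  [∀ k, ContinuousSMul ℝ (G k)] [∀ k, HasConvexBalls (G k)]
  (τ : SpaceTower W G)

omit [∀ k, ContinuousSMul ℝ (G k)] in
-- Only indices `k' ≥ k` enter the tail. There the norm of level `k` is dominated by that of level
-- `k'`, in which the change is controlled, and the weights sum to at most 1.
theorem norm_ι_halvingSum_sub_le {y y' : ℕ → W} {z : W} {i k : ℕ} {ρ : ℝ} (hy : ∀ k ≥ i, y k = z)
    (hy' : ∀ k ≥ i + 1, y' k = z) (hρ : ∀ k', ‖τ.ι k' (y' k' - y k')‖ ≤ ρ) :
    ‖τ.ι k (halvingSum y' z (i + 1) - ∑ k' ∈ Finset.range k, (1 / 2 : ℝ) ^ (k' + 1) • y' k') -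
      τ.ι k (halvingSum y z i - ∑ k' ∈ Finset.range k, (1 / 2 : ℝ) ^ (k' + 1) • y k')‖ ≤ ρ := by
  have hk : k ≤ max (i + 1) k := le_max_right _ _
  have h1 : halvingSum y' z (i + 1) - ∑ k' ∈ Finset.range k, (1 / 2 : ℝ) ^ (k' + 1) • y' k' -
      (halvingSum y z i - ∑ k' ∈ Finset.range k, (1 / 2 : ℝ) ^ (k' + 1) • y k') =
      ∑ k' ∈ Finset.range (max (i + 1) k), (1 / 2 : ℝ) ^ (k' + 1) •
        (if k' < k then 0 else y' k' - y k') := by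
    rw [halvingSum, halvingSum, ← sum_halving_eq hy' (le_max_left (i + 1) k),
      ← sum_halving_eq hy ((Nat.le_succ i).trans (le_max_left (i + 1) k)),
      ← Finset.sum_range_add_sum_Ico _ hk, ← Finset.sum_range_add_sum_Ico _ hk,
      ← Finset.sum_range_add_sum_Ico _ hk]
    have h2 : ∑ k' ∈ Finset.range k, (1 / 2 : ℝ) ^ (k' + 1) •
        (if k' < k then 0 else y' k' - y k') = 0 :=
      Finset.sum_eq_zero fun k' hk' => by rw [if_pos (Finset.mem_range.1 hk'), smul_zero]
    have h3 : ∑ k' ∈ Finset.Ico k (max (i + 1) k), (1 / 2 : ℝ) ^ (k' + 1) •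
        (if k' < k then 0 else y' k' - y k') = ∑ k' ∈ Finset.Ico k (max (i + 1) k),
          ((1 / 2 : ℝ) ^ (k' + 1) • y' k' - (1 / 2 : ℝ) ^ (k' + 1) • y k') :=
      Finset.sum_congr rfl fun k' hk' => by
        rw [if_neg (not_lt.2 (Finset.mem_Ico.1 hk').1), smul_sub]
    rw [h2, h3, Finset.sum_sub_distrib]
    abel
  rw [← map_sub, h1, map_sum]
  simp only [map_smul]
  refine norm_sum_halving_le _ fun k' => ?_
  split_ifs with h
  · rw [map_zero, norm_zero]; exact (norm_nonneg _).trans (hρ 0)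
  · exact (τ.norm_ι_mono (not_lt.1 h) _).trans (hρ k')

/-- Into the bottom level of a tower one can map a compact metrizable space injectively such that
the preimage of the intersection of the tower is a given `F_{σδ}`-set. -/
theorem exists_injective_map [HasConvexBalls W] [ContinuousSMul ℝ W] [CompleteSpace W]
    [SecondCountableTopology W] [∀ k, CompleteSpace (G k)]
    {K : Type w} [TopologicalSpace K] [CompactSpace K] [TopologicalSpace.MetrizableSpace K]
    {φ : ℕ → ℕ → K → ℝ} (hφc : ∀ k i, Continuous (φ k i)) (hφ : ∀ k i x, φ k i x ∈ Icc (0 : ℝ) 1)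
    (hφm : ∀ k i x, φ k i x = 0 → φ k (i + 1) x = 0) :
    ∃ g : K → G 0, Continuous g ∧ Function.Injective g ∧ (∀ x, g x ∈ τ.C) ∧
      ∀ x, g x ∈ range (τ.ι 0) ↔ ∀ k, ∃ i, φ k i x = 0 := by
  obtain ⟨T, hTc, hTC, hTf, ⟨h, hh, hhT⟩, hdisj⟩ := τ.exists_family K
  let _ := TopologicalSpace.metrizableSpaceMetric K
  obtain ⟨s, hs, hR⟩ := τ.exists_stages hTc hTC hTf hh hhT hdisj hφc hφ hφm
  have hsR : ∀ i k x, ‖τ.ι k ((s (i + 1)).1 k x - (s i).1 k x)‖ ≤ (s i).2 k x :=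
    fun i k x => (hR i k x).1
  have hsr : ∀ i k x, (s (i + 1)).2 k x ≤ (s i).2 k x / 2 := fun i k x => (hR i k x).2
  choose e he hre hm1 hm2 hm3 using fun i => (hs i).margin
  have hr : ∀ i n k x, (s (i + n)).2 k x ≤ e i * (1 / 2) ^ n := fun i n k x => by
    induction n with
    | zero => simpa using hre i k x
    | succ n ih =>
      have := hsr (i + n) k x
      rw [pow_succ]
      exact this.trans (by linarith)
  -- The tail from index `k` of the `i`-th approximation to the series. It converges at level `k`,
  -- to `L k x`; the map sought is `L 0`.
  set Q : ℕ → ℕ → K → W := fun k i x => halvingSum (fun k => (s i).1 k x) (h x) i -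
    ∑ k' ∈ Finset.range k, (1 / 2 : ℝ) ^ (k' + 1) • (s i).1 k' x with hQ
  have hQd : ∀ k i n x, ‖τ.ι k (Q k (i + (n + 1)) x) - τ.ι k (Q k (i + n) x)‖ ≤ e i * (1 / 2) ^ n :=
    fun k i n x => τ.norm_ι_halvingSum_sub_le
      (fun k hk => by rw [(hs (i + n)).idle k hk])
      (fun k hk => by rw [(hs (i + (n + 1))).idle k hk])
      fun k' => (hsR (i + n) k' x).trans (hr i n k' x)
  have hL : ∀ k x, ∃ L, Tendsto (fun i => τ.ι k (Q k i x)) atTop (𝓝 L) ∧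
      (∀ i, ‖L - τ.ι k (Q k i x)‖ ≤ 2 * e i) ∧
      ∀ i, ‖L - τ.ι k (Q k i x)‖ ≤ 2 * (e 0 * (1 / 2) ^ i) := fun k x => by
    have h1 : ∀ i, ∃ L, Tendsto (fun n => τ.ι k (Q k (i + n) x)) atTop (𝓝 L) ∧
        ∀ m, ‖L - τ.ι k (Q k (i + m) x)‖ ≤ 2 * (e i * (1 / 2) ^ m) := fun i =>
      exists_tendsto_of_halving (ρ := fun n => e i * (1 / 2) ^ n)
        (fun n => mul_nonneg (he i).le (by positivity))
        (fun n => le_of_eq (by ring)) fun n => hQd k i n x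
    obtain ⟨L, hLt, hLb⟩ := h1 0
    simp only [zero_add] at hLt hLb
    refine ⟨L, hLt, fun i => ?_, hLb⟩
    obtain ⟨L', hLt', hLb'⟩ := h1 i
    have h2 : Tendsto (fun n => τ.ι k (Q k (i + n) x)) atTop (𝓝 L) :=
      hLt.comp (tendsto_atTop_mono (fun n => Nat.le_add_left n i) tendsto_id)
    rw [tendsto_nhds_unique h2 hLt']
    simpa using hLb' 0
  choose L hLt hLb hLu using hL
  have hg : ∀ k x, ∃ g, Tendsto (fun i => τ.ι k ((s i).1 k x)) atTop (𝓝 g) ∧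
      ∀ m, ‖g - τ.ι k ((s m).1 k x)‖ ≤ 2 * (s m).2 k x := fun k x =>
    exists_tendsto_of_halving (ρ := fun n => (s n).2 k x) (fun n => (hs n).r_nonneg k x)
      (fun n => hsr n k x) fun n => by rw [← map_sub]; exact hsR n k x
  choose g hgt hgb using hg
  have hgC : ∀ k x, τ.J k (g k x) ∈ τ.C := fun k x => by
    rw [τ.C_eq]
    refine mem_iInter.2 fun n => hm1 n k x _ ?_
    rw [← τ.J_ι k, ← map_sub]
    exact (τ.norm_J_le k _).trans ((hgb k x n).trans (by linarith [hre n k x]))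
  have hJL : ∀ k x, τ.J k (L k x) = L 0 x -
      ∑ k' ∈ Finset.range k, (1 / 2 : ℝ) ^ (k' + 1) • τ.J k' (g k' x) := fun k x => by
    have h1 : Tendsto (fun i => τ.J k (τ.ι k (Q k i x))) atTop (𝓝 (τ.J k (L k x))) :=
      ((τ.continuous_J k).tendsto _).comp (hLt k x)
    have h2 : Tendsto (fun i => τ.ι 0 (Q 0 i x) -
        ∑ k' ∈ Finset.range k, (1 / 2 : ℝ) ^ (k' + 1) • τ.J k' (τ.ι k' ((s i).1 k' x))) atTop
        (𝓝 (L 0 x - ∑ k' ∈ Finset.range k, (1 / 2 : ℝ) ^ (k' + 1) • τ.J k' (g k' x))) :=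
      (hLt 0 x).sub (tendsto_finsetSum _ fun k' _ =>
        (((τ.continuous_J k').tendsto _).comp (hgt k' x)).const_smul _)
    refine tendsto_nhds_unique h1 (h2.congr fun i => ?_)
    simp only [τ.J_ι, hQ, map_sub, map_sum, map_smul, Finset.range_zero, Finset.sum_empty,
      sub_zero]
  -- Once the radius is 0 the value never moves again, so the limit is the value of that stage, an
  -- element of `W`.
  have hgι : ∀ k x, (∃ i, φ k i x = 0) → τ.J k (g k x) ∈ range (τ.ι 0) := by
    rintro k x ⟨i, hi⟩
    have h1 := hgb k x i
    rw [(hs i).r_zero k x hi, mul_zero] at h1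
    rw [sub_eq_zero.1 (norm_le_zero_iff.1 h1), τ.J_ι]
    exact mem_range_self _
  -- The limit lies in `τ.U k j` for every `j`, whereas the complements of these sets cover the
  -- points of `τ.C` coming from level `k + 1`.
  have hgn : ∀ k x, (∀ i, φ k i x ≠ 0) → τ.J k (g k x) ∉ range (τ.J (k + 1)) := fun k x hx hmem => by
    obtain ⟨j, hj⟩ := τ.exists_notMem_U k _ (hgC k x) hmem
    exact hj ((hs (max k j + 1)).avoid k (Nat.lt_succ_of_le (le_max_left _ _)) j
      (Nat.lt_succ_of_le (le_max_right _ _)) x (hx _) _ (hgb k x _))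
  have hQ0 : ∀ i x, Q 0 i x = halvingSum (fun k => (s i).1 k x) (h x) i := fun i x => by simp [hQ]
  refine ⟨L 0, ?_, fun x y hxy => ?_, fun x => ?_, fun x => ⟨fun hx => ?_, fun hx => ?_⟩⟩
  · have h1 : TendstoUniformly (fun i x => τ.ι 0 (Q 0 i x)) (L 0) atTop := by
      rw [Metric.tendstoUniformly_iff]
      intro ε hε
      have h2 : Tendsto (fun i : ℕ => 2 * (e 0 * (1 / 2 : ℝ) ^ i)) atTop (𝓝 0) := by
        simpa using ((tendsto_pow_atTop_nhds_zero_of_lt_one (by norm_num)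
          (by norm_num : (1 / 2 : ℝ) < 1)).const_mul (e 0)).const_mul 2
      filter_upwards [h2.eventually_lt_const hε] with i hi x
      rw [dist_eq_norm]
      exact (hLu 0 x i).trans_lt hi
    refine h1.continuous (Frequently.of_forall fun i => ?_)
    simp only [hQ0, halvingSum, map_add, map_sum, map_smul]
    refine (continuous_finsetSum _ fun k _ => ?_).add
      (((τ.continuous_ι 0).comp hh).const_smul _)
    have h2 : Continuous fun x => τ.ι 0 ((s i).1 k x) := by
      simpa only [Function.comp_def, τ.J_ι] using (τ.continuous_J k).comp ((hs i).cont k)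
    exact h2.const_smul _
  -- Each approximation is within `2 * e i` of its limit, while approximations at points more than
  -- `(1 / 2) ^ i` apart differ by more than `4 * e i`.
  · by_contra hne
    obtain ⟨i, hi⟩ := exists_pow_lt_of_lt_one (dist_pos.2 hne) (by norm_num : (1 / 2 : ℝ) < 1)
    have h1 := hm3 i x y hi.le
    rw [← hQ0, ← hQ0] at h1
    have h2 := hLb 0 x i
    have h3 := hLb 0 y i
    rw [← hxy] at h3
    have h4 := norm_sub_le (L 0 x - τ.ι 0 (Q 0 i y)) (L 0 x - τ.ι 0 (Q 0 i x))
    rw [sub_sub_sub_cancel_left] at h4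
    linarith
  · rw [τ.C_eq]
    refine mem_iInter.2 fun n => hm2 n x _ ?_
    rw [← hQ0]
    exact hLb 0 x n
  · intro k
    -- At the first bad index `k` the earlier terms are smooth and the tail from `k + 1` comes from
    -- level `k + 1`. If the sum is smooth, the `k`-th term must come from level `k + 1` too.
    induction k using Nat.strong_induction_on with
    | _ k ih =>
      by_contra! hcon
      refine hgn k x hcon ?_
      have hιJ : ∀ z ∈ range (τ.ι 0), z ∈ LinearMap.range (τ.J (k + 1)) := by
        rintro _ ⟨w, rfl⟩
        exact τ.ι_mem_range_J (k + 1) w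
      have h1 := hJL (k + 1) x
      rw [Finset.sum_range_succ] at h1
      have h2 : (1 / 2 : ℝ) ^ (k + 1) • τ.J k (g k x) ∈ LinearMap.range (τ.J (k + 1)) := by
        have h3 : (1 / 2 : ℝ) ^ (k + 1) • τ.J k (g k x) = L 0 x -
            ∑ k' ∈ Finset.range k, (1 / 2 : ℝ) ^ (k' + 1) • τ.J k' (g k' x) -
            τ.J (k + 1) (L (k + 1) x) := by rw [h1]; abel
        rw [h3]
        exact Submodule.sub_mem _ (Submodule.sub_mem _ (hιJ _ hx) (Submodule.sum_mem _ fun k' hk' =>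
          Submodule.smul_mem _ _ (hιJ _ (hgι k' x (ih k' (Finset.mem_range.1 hk'))))))
          (LinearMap.mem_range_self _ _)
      exact (Submodule.smul_mem_iff _ (by positivity)).1 h2
  · refine τ.mem_range_ι _ fun k => ?_
    have h1 : L 0 x = τ.J k (L k x) +
        ∑ k' ∈ Finset.range k, (1 / 2 : ℝ) ^ (k' + 1) • τ.J k' (g k' x) := by rw [hJL]; abel
    have h2 : L 0 x ∈ LinearMap.range (τ.J k) := by
      rw [h1]
      refine Submodule.add_mem _ (LinearMap.mem_range_self _ _) (Submodule.sum_mem _ fun k' _ =>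
        Submodule.smul_mem _ _ ?_)
      obtain ⟨w, hw⟩ := hgι k' x (hx k')
      rw [← hw]
      exact τ.ι_mem_range_J k w
    exact h2

end SpaceTower

/-! ### The F-norm of a sequence of seminorms -/

section FNorm

variable {E : Type*} [AddCommGroup E] [Module ℝ E]

/-- The F-norm `f ↦ sup_j min (2⁻ʲ, p j f)`. -/
noncomputable def fNorm (p : ℕ → Seminorm ℝ E) (f : E) : ℝ := ⨆ j, min ((1 / 2 : ℝ) ^ j) (p j f)

variable {p : ℕ → Seminorm ℝ E}

theorem bddAbove_fNorm (p : ℕ → Seminorm ℝ E) (f : E) :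
    BddAbove (range fun j => min ((1 / 2 : ℝ) ^ j) (p j f)) :=
  ⟨1, by
    rintro _ ⟨j, rfl⟩
    exact (min_le_left _ _).trans (pow_le_one₀ (by norm_num) (by norm_num))⟩

theorem le_fNorm (p : ℕ → Seminorm ℝ E) (f : E) (j : ℕ) :
    min ((1 / 2 : ℝ) ^ j) (p j f) ≤ fNorm p f := le_ciSup (bddAbove_fNorm p f) j

theorem fNorm_le_of_forall {f : E} {c : ℝ} (h : ∀ j, min ((1 / 2 : ℝ) ^ j) (p j f) ≤ c) :
    fNorm p f ≤ c := ciSup_le h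

theorem fNorm_nonneg (f : E) : 0 ≤ fNorm p f :=
  (le_min (by positivity) (apply_nonneg _ _)).trans (le_fNorm p f 0)

theorem fNorm_mono {E' : Type*} [AddCommGroup E'] [Module ℝ E'] {p' : ℕ → Seminorm ℝ E'}
    {f : E} {f' : E'} (h : ∀ j, p j f ≤ p' j f') : fNorm p f ≤ fNorm p' f' :=
  fNorm_le_of_forall fun j => (min_le_min_left _ (h j)).trans (le_fNorm p' f' j)

/-- `fNorm` as an additive group norm. -/
noncomputable def fNormGroupNorm (p : ℕ → Seminorm ℝ E) (hp : ∀ f, (∀ j, p j f = 0) → f = 0) :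
    AddGroupNorm E where
  toFun := fNorm p
  map_zero' := le_antisymm (fNorm_le_of_forall fun j => by simp) (fNorm_nonneg 0)
  add_le' f g := fNorm_le_of_forall fun j => by
    refine le_trans ?_ (add_le_add (le_fNorm p f j) (le_fNorm p g j))
    have h1 := map_add_le_add (p j) f g
    have h2 := apply_nonneg (p j) f
    have h3 := apply_nonneg (p j) g
    have h4 : (0 : ℝ) < (1 / 2) ^ j := by positivity
    rcases le_total ((1 / 2 : ℝ) ^ j) (p j f) with h | h <;>
      rcases le_total ((1 / 2 : ℝ) ^ j) (p j g) with h' | h' <;>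
      simp only [min_eq_left h, min_eq_right h, min_eq_left h', min_eq_right h'] <;>
      first
      | exact (min_le_left _ _).trans (by linarith)
      | exact (min_le_right _ _).trans (by linarith)
  neg' f := by simp only [fNorm, map_neg_eq_map]
  eq_zero_of_map_eq_zero' f hf := hp f fun j => by
    have h1 : min ((1 / 2 : ℝ) ^ j) (p j f) ≤ 0 := (le_fNorm p f j).trans hf.le
    have h2 : (0 : ℝ) < (1 / 2) ^ j := by positivity
    rcases min_le_iff.1 h1 with h | h
    · exact absurd h (not_le.2 h2)
    · exact le_antisymm h (apply_nonneg _ _)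

/-- A seminorm of a convex combination is at most the maximum of its values at the two points, and
this quasi-convexity survives truncation and suprema. It is the reason for a supremum in `fNorm`. -/
theorem convex_fNorm_lt (p : ℕ → Seminorm ℝ E) (r : ℝ) : Convex ℝ {f | fNorm p f < r} := by
  intro f hf g hg a b ha hb hab
  refine lt_of_le_of_lt (fNorm_le_of_forall fun j => ?_) (max_lt hf hg)
  have h1 : p j (a • f + b • g) ≤ max (p j f) (p j g) := by
    refine (map_add_le_add (p j) _ _).trans ?_
    rw [map_smul_eq_mul, map_smul_eq_mul, Real.norm_of_nonneg ha, Real.norm_of_nonneg hb]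
    calc a * p j f + b * p j g ≤ a * max (p j f) (p j g) + b * max (p j f) (p j g) := by
          gcongr
          · exact le_max_left _ _
          · exact le_max_right _ _
      _ = max (p j f) (p j g) := by rw [← add_mul, hab, one_mul]
  calc min ((1 / 2 : ℝ) ^ j) (p j (a • f + b • g)) ≤ min ((1 / 2 : ℝ) ^ j) (max (p j f) (p j g)) :=
        min_le_min_left _ h1
    _ = max (min ((1 / 2 : ℝ) ^ j) (p j f)) (min ((1 / 2 : ℝ) ^ j) (p j g)) := min_max_distrib_left ..
    _ ≤ _ := max_le_max (le_fNorm p f j) (le_fNorm p g j)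

theorem exists_forall_fNorm_lt (p : ℕ → Seminorm ℝ E) {ε : ℝ} (hε : 0 < ε) :
    ∃ J : ℕ, ∀ f, (∀ j < J, p j f < ε / 2) → fNorm p f < ε := by
  obtain ⟨J, hJ⟩ := exists_pow_lt_of_lt_one (half_pos hε) (by norm_num : (1 / 2 : ℝ) < 1)
  refine ⟨J, fun f hf => lt_of_le_of_lt (fNorm_le_of_forall fun j => ?_) (half_lt_self hε)⟩
  rcases lt_or_ge j J with h | h
  · exact (min_le_right _ _).trans (hf j h).le
  · exact (min_le_left _ _).trans
      ((pow_le_pow_of_le_one (by norm_num) (by norm_num) h).trans hJ.le)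

theorem exists_forall_lt_of_fNorm_lt (p : ℕ → Seminorm ℝ E) {ε : ℝ} (hε : 0 < ε) (J : ℕ) :
    ∃ δ > 0, ∀ f, fNorm p f < δ → ∀ j < J, p j f < ε := by
  refine ⟨min ε ((1 / 2) ^ J), by positivity, fun f hf j hj => ?_⟩
  have h1 := (le_fNorm p f j).trans_lt hf
  rcases min_lt_iff.1 h1 with h | h
  · have h2 := h.trans_le (min_le_right _ _)
    exact absurd (pow_le_pow_of_le_one (by norm_num) (by norm_num) hj.le) (not_le.2 h2)
  · exact h.trans_le (min_le_left _ _)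

/-- The topology of the F-norm is the topology defined by the seminorms `q`, if the families `p`
and `q` are equivalent. -/
theorem fNorm_topology_eq {ι : Type*} {q : SeminormFamily ℝ E ι}
    [t : TopologicalSpace E] (hq : WithSeminorms q) (hp : ∀ f, (∀ j, p j f = 0) → f = 0)
    (hpq : ∀ j, Continuous (p j))
    (hqp : ∀ i, ∃ C : ℝ, ∃ J : ℕ, ∀ f, ∀ c ≥ 0, (∀ j < J, p j f ≤ c) → q i f ≤ C * c) :
    t = (fNormGroupNorm p hp).toNormedAddCommGroup.toMetricSpace.toUniformSpace.toTopologicalSpace := by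
  have h1 : IsTopologicalAddGroup E := hq.topologicalAddGroup
  let N := (fNormGroupNorm p hp).toNormedAddCommGroup
  have h2 : @IsTopologicalAddGroup E N.toMetricSpace.toUniformSpace.toTopologicalSpace _ :=
    @SeminormedAddCommGroup.toIsTopologicalAddGroup E N.toSeminormedAddCommGroup
  -- Both are group topologies, so comparing neighbourhoods of 0 is enough.
  refine IsTopologicalAddGroup.ext h1 h2 ?_
  have hb := @Metric.nhds_basis_ball E N.toPseudoMetricSpace 0
  have hball : ∀ ε, @Metric.ball E N.toPseudoMetricSpace 0 ε = {f | fNorm p f < ε} := fun ε => by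
    ext f
    rw [@Metric.mem_ball, @dist_zero_right E N.toSeminormedAddCommGroup.toSeminormedAddGroup]
    rfl
  refine le_antisymm (hb.ge_iff.2 fun ε hε => ?_) (hq.hasBasis_zero_ball.ge_iff.2 ?_)
  · rw [hball]
    obtain ⟨J, hJ⟩ := exists_forall_fNorm_lt p hε
    refine mem_of_superset (x := ⋂ j ∈ Finset.range J, {f | p j f < ε / 2}) ?_ fun f hf => hJ f ?_
    · refine (Filter.biInter_finset_mem _).2 fun j _ => ?_
      refine (isOpen_lt (hpq j) continuous_const).mem_nhds ?_
      simpa using hε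
    · simpa using hf
  · rintro ⟨s, r⟩ hr
    have hr : 0 < r := hr
    choose C J hCJ using hqp
    have h3 : ∀ i, ∃ δ > 0, ∀ f, fNorm p f < δ → q i f < r := fun i => by
      obtain ⟨δ, hδ, h⟩ := exists_forall_lt_of_fNorm_lt p
        (show 0 < r / (2 * (|C i| + 1)) by positivity) (J i)
      refine ⟨δ, hδ, fun f hf => ?_⟩
      calc q i f ≤ C i * (r / (2 * (|C i| + 1))) :=
            hCJ i f _ (by positivity) fun j hj => (h f hf j hj).le
        _ ≤ (|C i| + 1) * (r / (2 * (|C i| + 1))) := by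
            gcongr
            linarith [le_abs_self (C i)]
        _ = r / 2 := by field_simp
        _ < r := half_lt_self hr
    choose δ hδ hδq using h3
    have h4 : (s.sup q).ball 0 r = ⋂ i ∈ s, {f | q i f < r} := by
      rw [Seminorm.ball_finset_sup _ _ _ hr]
      ext f
      simp [Seminorm.mem_ball]
    rw [h4, Filter.biInter_finset_mem]
    intro i _
    refine mem_of_superset (hb.mem_of_mem (hδ i)) fun f hf => ?_
    rw [hball] at hf
    exact hδq i f hf

end FNorm

/-! ### Completeness and separability of spaces of differentiable functions -/

/-- A limit of functions all of whose derivatives converge uniformly is differentiable. -/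
theorem contDiffOn_of_uniformCauchySeqOn {E F : Type*} [NormedAddCommGroup E] [NormedSpace ℝ E]
    [NormedAddCommGroup F] [NormedSpace ℝ F] [CompleteSpace F] {U : Set E} (hU : IsOpen U)
    {γ : ℕ∞} {f : ℕ → E → F} (hf : ∀ n, ContDiffOn ℝ γ (f n) U)
    (hc : ∀ b : ℕ, (b : ℕ∞) ≤ γ → UniformCauchySeqOn (fun n => iteratedFDeriv ℝ b (f n)) atTop U)
    {g : E → F} (hg : ∀ z ∈ U, Tendsto (fun n => f n z) atTop (𝓝 (g z))) :
    ContDiffOn ℝ γ g U ∧ ∀ b : ℕ, (b : ℕ∞) ≤ γ →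
      TendstoUniformlyOn (fun n => iteratedFDeriv ℝ b (f n)) (iteratedFDeriv ℝ b g) atTop U := by
  have hlim : ∀ (b : ℕ) (z : E), ∃ l, (b : ℕ∞) ≤ γ → z ∈ U →
      Tendsto (fun n => iteratedFDeriv ℝ b (f n) z) atTop (𝓝 l) := fun b z => by
    by_cases h : (b : ℕ∞) ≤ γ ∧ z ∈ U
    · obtain ⟨l, hl⟩ := cauchySeq_tendsto_of_complete ((hc b h.1).cauchySeq h.2)
      exact ⟨l, fun _ _ => hl⟩
    · exact ⟨0, fun h1 h2 => absurd ⟨h1, h2⟩ h⟩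
  choose q hq using hlim
  have hu : ∀ b : ℕ, (b : ℕ∞) ≤ γ →
      TendstoUniformlyOn (fun n => iteratedFDeriv ℝ b (f n)) (q b) atTop U := fun b hb =>
    (hc b hb).tendstoUniformlyOn_of_tendsto fun z hz => hq b z hb hz
  have hat : ∀ n, ∀ z ∈ U, ContDiffAt ℝ γ (f n) z := fun n z hz =>
    (hf n).contDiffAt (hU.mem_nhds hz)
  -- The limits of the derivatives form a Taylor series of `g`: uniform convergence of derivatives
  -- allows differentiation of the limit, one order at a time.
  have htaylor : HasFTaylorSeriesUpToOn (γ : WithTop ℕ∞) g (fun z b => q b z) U := by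
    refine ⟨fun z hz => ?_, fun b hb z hz => ?_, fun b hb => ?_⟩
    · have h1 := hq 0 z (by simp) hz
      have h2 : Tendsto (fun n => (iteratedFDeriv ℝ 0 (f n) z).curry0) atTop
          (𝓝 (q 0 z).curry0) :=
        ((continuousMultilinearCurryFin0 ℝ E F).continuous.tendsto _).comp h1
      exact tendsto_nhds_unique h2 (hg z hz)
    · have hb' : ((b + 1 : ℕ) : ℕ∞) ≤ γ := by
        have : (b : ℕ∞) < γ := by exact_mod_cast hb
        exact_mod_cast Order.add_one_le_of_lt this
      have hb0 : (b : ℕ∞) ≤ γ := by exact_mod_cast hb.le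
      refine (hasFDerivAt_of_tendstoUniformlyOn (𝕜 := ℝ) (l := atTop)
        (f := fun n => iteratedFDeriv ℝ b (f n))
        (f' := fun n z => (iteratedFDeriv ℝ (b + 1) (f n) z).curryLeft)
        (g' := fun z => (q (b + 1) z).curryLeft) hU ?_ (fun n z hz => ?_)
        (fun z hz => hq b z hb0 hz) hz).hasFDerivWithinAt
      · exact (continuousMultilinearCurryLeftEquiv ℝ (fun _ : Fin (b + 1) => E)
          F).isometry.uniformContinuous.comp_tendstoUniformlyOn (hu (b + 1) hb')
      · have h1 := ((hat n z hz).differentiableAt_iteratedFDeriv hb).hasFDerivAt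
        rw [fderiv_iteratedFDeriv] at h1
        exact h1
    · have hb0 : (b : ℕ∞) ≤ γ := by exact_mod_cast hb
      refine (hu b hb0).continuousOn (Frequently.of_forall fun n z hz => ?_)
      exact ((hat n z hz).continuousAt_iteratedFDeriv hb).continuousWithinAt
  refine ⟨htaylor.contDiffOn, fun b hb => (hu b hb).congr_right fun z hz => ?_⟩
  have hb' : (b : WithTop ℕ∞) ≤ (γ : WithTop ℕ∞) := by exact_mod_cast hb
  rw [htaylor.eq_iteratedFDerivWithin_of_uniqueDiffOn hb' hU.uniqueDiffOn hz,
    iteratedFDerivWithin_of_isOpen b hU hz]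

/-! ### Countable systems of charts and comparison of seminorms -/

namespace CSpace

variable {m : ℕ} {V : Type u} [TopologicalSpace V]
  [ChartedSpace (EuclideanSpace ℝ (Fin m)) V] {γ : ℕ∞}

instance (i : SeminormIndex m V γ) : CompactSpace ↥i.K := isCompact_iff_compactSpace.1 i.isCompact_K

variable (m V) in
/-- Countably many compact sets in charts whose interiors cover `V`. -/
structure Pieces where
  toFun : ℕ → Option (SeminormIndex m V 0)
  cover : ∀ x : V, ∃ a i, toFun a = some i ∧ x ∈ i.chart.source ∧ i.chart x ∈ interior i.K

variable (m V) in
theorem exists_pieces [T2Space V] [SigmaCompactSpace V] : Nonempty (Pieces m V) := by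
  have : SecondCountableTopology V :=
    ChartedSpace.secondCountable_of_sigmaCompact (EuclideanSpace ℝ (Fin m)) V
  have h1 : ∀ x : V, ∃ i : SeminormIndex m V 0, x ∈ i.chart.source ∧ i.chart x ∈ interior i.K :=
    fun x => by
      set φ := chartAt (EuclideanSpace ℝ (Fin m)) x
      have hx : x ∈ φ.source := mem_chart_source _ x
      obtain ⟨K, hK, hxK, hKs⟩ := exists_compact_subset φ.open_target (φ.map_source hx)
      exact ⟨⟨φ, chart_mem_atlas _ x, K, hK, hKs, 0, le_rfl⟩, hx, hxK⟩
  choose i hi hiK using h1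
  obtain ⟨s, hs, hcov⟩ := TopologicalSpace.countable_cover_nhds
    (f := fun x => (i x).chart.source ∩ (i x).chart ⁻¹' interior (i x).K) fun x =>
      ((i x).chart.isOpen_inter_preimage isOpen_interior).mem_nhds ⟨hi x, hiK x⟩
  have : Countable ↥s := hs.to_subtype
  let _ := Encodable.ofCountable ↥s
  refine ⟨⟨fun a => (Encodable.decode (α := ↥s) a).map fun x => i x, fun x => ?_⟩⟩
  obtain ⟨y, hy, hxy⟩ := mem_iUnion₂.1 (hcov.symm ▸ mem_univ x)
  exact ⟨Encodable.encode (⟨y, hy⟩ : ↥s), i y, by simp, hxy.1, hxy.2⟩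

/-- The same compact set with another order of differentiation. -/
def SeminormIndex.ofOrder (i : SeminormIndex m V 0) (b : ℕ) (hb : (b : ℕ∞) ≤ γ) :
    SeminormIndex m V γ :=
  ⟨i.chart, i.chart_mem, i.K, i.isCompact_K, i.K_subset, b, hb⟩

variable [IsManifold (𝓡 m) ∞ V]

theorem norm_le_seminorm (i : SeminormIndex m V γ) (f : CSpace m V γ)
    {y : EuclideanSpace ℝ (Fin m)} (hy : y ∈ i.K) :
    ‖iteratedFDeriv ℝ i.k ((f : V → ℝ) ∘ i.chart.symm) y‖ ≤ seminorm i f :=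
  le_ciSup (f.bddAbove_norm i) (⟨y, hy⟩ : i.K)

theorem seminorm_le_of_forall (i : SeminormIndex m V γ) (f : CSpace m V γ) {c : ℝ} (hc : 0 ≤ c)
    (h : ∀ y ∈ i.K, ‖iteratedFDeriv ℝ i.k ((f : V → ℝ) ∘ i.chart.symm) y‖ ≤ c) :
    seminorm i f ≤ c :=
  Real.iSup_le (fun y => h y y.2) hc

theorem continuous_seminorm (i : SeminormIndex m V γ) : Continuous (seminorm i) :=
  (withSeminorms (m := m) (V := V) (γ := γ)).continuous_seminorm i

/-- Derivatives in one chart are locally bounded by derivatives in another one. -/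
theorem exists_bound_of_charts {φ ψ : OpenPartialHomeomorph V (EuclideanSpace ℝ (Fin m))}
    (hφ : φ ∈ atlas (EuclideanSpace ℝ (Fin m)) V) (hψ : ψ ∈ atlas (EuclideanSpace ℝ (Fin m)) V)
    {U : Set (EuclideanSpace ℝ (Fin m))} (hU : IsOpen U) (hUψ : U ⊆ ψ.target)
    {y : EuclideanSpace ℝ (Fin m)} (hy : y ∈ φ.target) (hyψ : φ.symm y ∈ ψ.source)
    (hyU : ψ (φ.symm y) ∈ U) (k : ℕ) :
    ∃ C : ℝ, 0 ≤ C ∧ ∃ S ∈ 𝓝 y, ∀ f : V → ℝ, ContDiffOn ℝ k (f ∘ ψ.symm) ψ.target → ∀ c : ℝ,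
      (∀ b ≤ k, ∀ z ∈ U, ‖iteratedFDeriv ℝ b (f ∘ ψ.symm) z‖ ≤ c) →
      ∀ z ∈ S, ‖iteratedFDeriv ℝ k (f ∘ φ.symm) z‖ ≤ C * c := by
  set t : EuclideanSpace ℝ (Fin m) → EuclideanSpace ℝ (Fin m) := ψ ∘ φ.symm with ht
  set s : Set (EuclideanSpace ℝ (Fin m)) :=
    φ.target ∩ φ.symm ⁻¹' (ψ.source ∩ ψ ⁻¹' U) with hs
  have hso : IsOpen s := φ.symm.isOpen_inter_preimage (ψ.isOpen_inter_preimage hU)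
  have hys : y ∈ s := ⟨hy, hyψ, hyU⟩
  have hst : MapsTo t s U := fun z hz => hz.2.2
  have hts : ContDiffOn ℝ k t s := by
    have hk' : (k : WithTop ℕ∞) ≤ ∞ := by exact_mod_cast le_top (a := (k : ℕ∞))
    have h1 : ContMDiffOn (𝓡 m) (𝓡 m) (k : WithTop ℕ∞) φ.symm φ.target :=
      (contMDiffOn_symm_of_mem_maximalAtlas
        (IsManifold.subset_maximalAtlas (n := ∞) hφ)).of_le hk'
    have h2 : ContMDiffOn (𝓡 m) (𝓡 m) (k : WithTop ℕ∞) ψ ψ.source :=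
      (contMDiffOn_of_mem_maximalAtlas
        (IsManifold.subset_maximalAtlas (n := ∞) hψ)).of_le hk'
    exact (h2.comp (h1.mono inter_subset_left) fun z hz => hz.2.1).contDiffOn
  -- A strict bound at `y`, hence near `y`, for the derivatives of the transition map. As `D ≥ 1`,
  -- it is at most `D ^ b` for `b ≥ 1`, the form required by the Faà di Bruno estimate.
  set D : ℝ := 1 + ∑ b ∈ Finset.range (k + 1), (‖iteratedFDerivWithin ℝ b t s y‖ + 1) with hD
  have hD1 : 1 ≤ D := by
    have : 0 ≤ ∑ b ∈ Finset.range (k + 1), (‖iteratedFDerivWithin ℝ b t s y‖ + 1) :=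
      Finset.sum_nonneg fun b _ => by positivity
    linarith
  have hDb : ∀ b ≤ k, ‖iteratedFDerivWithin ℝ b t s y‖ < D := fun b hb => by
    have := Finset.single_le_sum (f := fun b => ‖iteratedFDerivWithin ℝ b t s y‖ + 1)
      (s := Finset.range (k + 1)) (fun b _ => by positivity)
      (Finset.mem_range.2 (Nat.lt_succ_of_le hb))
    linarith
  have hev : ∀ᶠ z in 𝓝 y, z ∈ s ∧ ∀ b ∈ Finset.range (k + 1),
      ‖iteratedFDerivWithin ℝ b t s z‖ < D := by
    have h0 : ∀ᶠ z in 𝓝 y, z ∈ s := hso.mem_nhds hys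
    refine h0.and ((Filter.eventually_all_finset _).2 fun b hb => ?_)
    have hb : b ≤ k := Nat.lt_succ_iff.1 (Finset.mem_range.1 hb)
    have h1 : ContinuousAt (iteratedFDerivWithin ℝ b t s) y :=
      (hts.continuousOn_iteratedFDerivWithin (by exact_mod_cast hb)
        hso.uniqueDiffOn).continuousAt (hso.mem_nhds hys)
    exact h1.norm.eventually_lt continuousAt_const (hDb b hb)
  refine ⟨k.factorial * D ^ k, by positivity, _, hev, fun f hf c hc z hz => ?_⟩
  obtain ⟨hzs, hzD⟩ := hz
  have h1 := norm_iteratedFDerivWithin_comp_le (hf.mono hUψ) hts le_rfl hU.uniqueDiffOn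
    hso.uniqueDiffOn hst hzs (C := c) (D := D)
    (fun b hb => by
      rw [iteratedFDerivWithin_of_isOpen b hU (hst hzs)]
      exact hc b hb _ (hst hzs))
    (fun b hb hbk => (hzD b (Finset.mem_range.2 (Nat.lt_succ_of_le hbk))).le.trans
      (le_self_pow₀ hD1 (by omega)))
  have h2 : iteratedFDerivWithin ℝ k ((f ∘ ψ.symm) ∘ t) s z = iteratedFDeriv ℝ k (f ∘ φ.symm) z := by
    rw [← iteratedFDerivWithin_of_isOpen k hso hzs]
    refine iteratedFDerivWithin_congr (fun z' hz' => ?_) hzs k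
    simp only [ht, Function.comp_apply, ψ.left_inv hz'.2.1]
  rw [h2] at h1
  exact h1.trans (le_of_eq (by ring))

/-- Finitely many local comparisons of charts suffice on the compact set `i.K`. Bounds are assumed
only on the interiors of the pieces, because limits are first controlled on open sets. -/
theorem exists_seminorm_le (P : Pieces m V) (i : SeminormIndex m V γ) :
    ∃ C : ℝ, 0 ≤ C ∧ ∃ A : ℕ, ∀ f : CSpace m V γ, ∀ c : ℝ, 0 ≤ c →
      (∀ a < A, ∀ ι, P.toFun a = some ι → ∀ b ≤ i.k, ∀ z ∈ interior ι.K,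
        ‖iteratedFDeriv ℝ b ((f : V → ℝ) ∘ ι.chart.symm) z‖ ≤ c) → seminorm i f ≤ C * c := by
  suffices h : ∃ C : ℝ, 0 ≤ C ∧ ∃ A : ℕ, ∀ f : CSpace m V γ, ∀ c : ℝ, 0 ≤ c →
      (∀ a < A, ∀ ι, P.toFun a = some ι → ∀ b ≤ i.k, ∀ z ∈ interior ι.K,
        ‖iteratedFDeriv ℝ b ((f : V → ℝ) ∘ ι.chart.symm) z‖ ≤ c) →
      ∀ y ∈ i.K, ‖iteratedFDeriv ℝ i.k ((f : V → ℝ) ∘ i.chart.symm) y‖ ≤ C * c by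
    obtain ⟨C, hC, A, h⟩ := h
    exact ⟨C, hC, A, fun f c hc hf => seminorm_le_of_forall i f (mul_nonneg hC hc) (h f c hc hf)⟩
  refine i.isCompact_K.induction_on (p := fun S => ∃ C : ℝ, 0 ≤ C ∧ ∃ A : ℕ, ∀ f : CSpace m V γ,
      ∀ c : ℝ, 0 ≤ c → (∀ a < A, ∀ ι, P.toFun a = some ι → ∀ b ≤ i.k, ∀ z ∈ interior ι.K,
        ‖iteratedFDeriv ℝ b ((f : V → ℝ) ∘ ι.chart.symm) z‖ ≤ c) →
      ∀ y ∈ S, ‖iteratedFDeriv ℝ i.k ((f : V → ℝ) ∘ i.chart.symm) y‖ ≤ C * c)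
    ⟨0, le_rfl, 0, by simp⟩ ?_ ?_ ?_
  · rintro S S' hSS ⟨C, hC, A, h⟩
    exact ⟨C, hC, A, fun f c hc hf y hy => h f c hc hf y (hSS hy)⟩
  · rintro S S' ⟨C, hC, A, h⟩ ⟨C', hC', A', h'⟩
    refine ⟨max C C', hC.trans (le_max_left _ _), max A A', fun f c hc hf y hy => ?_⟩
    rcases hy with hy | hy
    · exact (h f c hc (fun a ha => hf a (ha.trans_le (le_max_left _ _))) y hy).trans
        (mul_le_mul_of_nonneg_right (le_max_left _ _) hc)
    · exact (h' f c hc (fun a ha => hf a (ha.trans_le (le_max_right _ _))) y hy).trans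
        (mul_le_mul_of_nonneg_right (le_max_right _ _) hc)
  · intro y hy
    obtain ⟨a, ι, ha, hxs, hxK⟩ := P.cover (i.chart.symm y)
    obtain ⟨C, hC, S, hS, h⟩ := exists_bound_of_charts i.chart_mem ι.chart_mem isOpen_interior
      (interior_subset.trans ι.K_subset) (i.K_subset hy) hxs hxK i.k
    refine ⟨S, mem_nhdsWithin_of_mem_nhds hS, C, hC, a + 1, fun f c hc hf z hz => ?_⟩
    exact h f (f.contDiffOn_comp_symm (ι.ofOrder i.k i.k_le)) c
      (fun b hb z' hz' => hf a (Nat.lt_succ_self a) ι ha b hb z' hz') z hz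

/-- The seminorms of the pieces of orders at most `γ`, as a sequence. -/
noncomputable def pieceSeminorm (P : Pieces m V) (γ : ℕ∞) (j : ℕ) : Seminorm ℝ (CSpace m V γ) :=
  open Classical in
  if h : (∃ i, P.toFun (Nat.unpair j).1 = some i) ∧ ((Nat.unpair j).2 : ℕ∞) ≤ γ then
    seminorm (h.1.choose.ofOrder _ h.2) else 0

theorem pieceSeminorm_eq {P : Pieces m V} {a b : ℕ} {i : SeminormIndex m V 0}
    (hi : P.toFun a = some i) (hb : (b : ℕ∞) ≤ γ) :
    pieceSeminorm P γ (Nat.pair a b) = seminorm (i.ofOrder b hb) := by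
  have h : (∃ i, P.toFun (Nat.unpair (Nat.pair a b)).1 = some i) ∧
      ((Nat.unpair (Nat.pair a b)).2 : ℕ∞) ≤ γ := by
    rw [Nat.unpair_pair]; exact ⟨⟨i, hi⟩, hb⟩
  rw [pieceSeminorm, dif_pos h]
  have h2 : h.1.choose = i := by
    have e : (Nat.unpair (Nat.pair a b)).1 = a := by rw [Nat.unpair_pair]
    have h3 : P.toFun a = some h.1.choose := (congrArg P.toFun e).symm.trans h.1.choose_spec
    exact Option.some.inj (h3.symm.trans hi)
  have h4 : (Nat.unpair (Nat.pair a b)).2 = b := by rw [Nat.unpair_pair]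
  congr 1
  rw [h2]
  simp only [SeminormIndex.ofOrder, h4]

theorem pieceSeminorm_cases (P : Pieces m V) (γ : ℕ∞) (j : ℕ) :
    (∃ (a b : ℕ) (i : SeminormIndex m V 0) (hb : (b : ℕ∞) ≤ γ), j = Nat.pair a b ∧ P.toFun a = some i ∧
      pieceSeminorm P γ j = seminorm (SeminormIndex.ofOrder i b hb)) ∨ pieceSeminorm P γ j = 0 := by
  by_cases h : (∃ i, P.toFun (Nat.unpair j).1 = some i) ∧ ((Nat.unpair j).2 : ℕ∞) ≤ γ
  · obtain ⟨⟨i, hi⟩, hb⟩ := h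
    refine Or.inl ⟨_, _, i, hb, (Nat.pair_unpair j).symm, hi, ?_⟩
    conv_lhs => rw [← Nat.pair_unpair j]
    exact pieceSeminorm_eq hi hb
  · right
    rw [pieceSeminorm, dif_neg h]

theorem continuous_pieceSeminorm (P : Pieces m V) (γ : ℕ∞) (j : ℕ) :
    Continuous (pieceSeminorm P γ j) := by
  rcases pieceSeminorm_cases P γ j with ⟨a, b, i, hb, -, -, h⟩ | h
  · rw [h]; exact continuous_seminorm _
  · rw [h]; exact continuous_const

theorem norm_le_pieceSeminorm {P : Pieces m V} {a b : ℕ} {i : SeminormIndex m V 0}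
    (hi : P.toFun a = some i) (hb : (b : ℕ∞) ≤ γ) (f : CSpace m V γ)
    {y : EuclideanSpace ℝ (Fin m)} (hy : y ∈ i.K) :
    ‖iteratedFDeriv ℝ b ((f : V → ℝ) ∘ i.chart.symm) y‖ ≤ pieceSeminorm P γ (Nat.pair a b) f := by
  rw [pieceSeminorm_eq hi hb]
  exact norm_le_seminorm (i.ofOrder b hb) f hy

theorem abs_le_pieceSeminorm {P : Pieces m V} {a : ℕ} {i : SeminormIndex m V 0}
    (hi : P.toFun a = some i) (f : CSpace m V γ) {x : V} (hx : x ∈ i.chart.source)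
    (hxK : i.chart x ∈ interior i.K) : |f x| ≤ pieceSeminorm P γ (Nat.pair a 0) f := by
  have h := norm_le_pieceSeminorm hi (b := 0) (by simp) f (interior_subset hxK)
  rwa [norm_iteratedFDeriv_zero, Function.comp_apply, i.chart.left_inv hx] at h

theorem eq_zero_of_pieceSeminorm (P : Pieces m V) (f : CSpace m V γ)
    (hf : ∀ j, pieceSeminorm P γ j f = 0) : f = 0 := by
  refine DFunLike.ext _ _ fun x => ?_
  obtain ⟨a, i, hi, hx, hxK⟩ := P.cover x
  have h := abs_le_pieceSeminorm hi f hx hxK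
  rw [hf] at h
  exact abs_nonpos_iff.1 h

theorem exists_seminorm_le_pieceSeminorm (P : Pieces m V) (i : SeminormIndex m V γ) :
    ∃ C : ℝ, ∃ J : ℕ, ∀ f : CSpace m V γ, ∀ c ≥ 0, (∀ j < J, pieceSeminorm P γ j f ≤ c) →
      seminorm i f ≤ C * c := by
  obtain ⟨C, -, A, h⟩ := exists_seminorm_le P i
  -- The square bounds every code `Nat.pair a b` with `a < A` and `b ≤ i.k`.
  refine ⟨C, Nat.pair A i.k + (A + i.k + 1) ^ 2 , fun f c hc hf => h f c hc
    fun a ha ι hι b hb z hz => ?_⟩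
  have hbγ : (b : ℕ∞) ≤ γ := le_trans (by exact_mod_cast hb) i.k_le
  refine (norm_le_pieceSeminorm hι hbγ f (interior_subset hz)).trans (hf _ ?_)
  have h1 := Nat.pair_lt_max_add_one_sq a b
  have h2 : (max a b + 1) ^ 2 ≤ (A + i.k + 1) ^ 2 :=
    Nat.pow_le_pow_left (by have := max_le_iff.2 ⟨ha.le.trans (Nat.le_add_right A i.k),
      hb.trans (Nat.le_add_left i.k A)⟩; omega) 2
  omega

end CSpace

/-! ### The spaces of functions as complete separable F-normed spaces -/

namespace CSpace

variable {m : ℕ} {V : Type u} [TopologicalSpace V]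
  [ChartedSpace (EuclideanSpace ℝ (Fin m)) V] [IsManifold (𝓡 m) ∞ V]

/-- The space `C^γ(V)` with the F-norm defined by the seminorms of the pieces `P`. -/
def FSpace (_P : Pieces m V) (γ : ℕ∞) : Type u := CSpace m V γ

namespace FSpace

variable {P : Pieces m V} {γ : ℕ∞}

noncomputable instance : AddCommGroup (FSpace P γ) := inferInstanceAs (AddCommGroup (CSpace m V γ))

noncomputable instance : Module ℝ (FSpace P γ) := inferInstanceAs (Module ℝ (CSpace m V γ))

/-- The topology is replaced by the original one of `CSpace m V γ`, so that hypotheses on closed,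
dense and Z-sets there apply definitionally to `FSpace P γ`. -/
noncomputable instance : NormedAddCommGroup (FSpace P γ) :=
  let N := (fNormGroupNorm (pieceSeminorm P γ) (eq_zero_of_pieceSeminorm P)).toNormedAddCommGroup
  { toNorm := N.toNorm
    toAddCommGroup := instAddCommGroup
    toMetricSpace := @MetricSpace.replaceTopology (CSpace m V γ) instTopologicalSpace
      N.toMetricSpace (fNorm_topology_eq withSeminorms (eq_zero_of_pieceSeminorm P)
        (continuous_pieceSeminorm P γ) (exists_seminorm_le_pieceSeminorm P))
    dist_eq := N.dist_eq }

instance : HasConvexBalls (FSpace P γ) where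
  convex_ball_zero r := by
    have h := convex_fNorm_lt (pieceSeminorm P γ) r
    rw [ball_zero_eq]
    exact h

instance : ContinuousSMul ℝ (FSpace P γ) :=
  (withSeminorms (m := m) (V := V) (γ := γ)).continuousSMul

theorem tendsto_zero_of_pieceSeminorm {ι : Type*} {l : Filter ι} {f : ι → FSpace P γ}
    (h : ∀ j, Tendsto (fun t => pieceSeminorm P γ j (f t)) l (𝓝 0)) : Tendsto f l (𝓝 0) := by
  refine Metric.nhds_basis_ball.tendsto_right_iff.2 fun ε hε => ?_
  obtain ⟨J, hJ⟩ := exists_forall_fNorm_lt (pieceSeminorm P γ) hε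
  have h1 : ∀ᶠ t in l, ∀ j < J, pieceSeminorm P γ j (f t) < ε / 2 :=
    (eventually_all_finite (finite_lt_nat J)).2 fun j _ =>
      (h j).eventually_lt_const (half_pos hε)
  filter_upwards [h1] with t ht
  rw [mem_ball_zero_iff]
  exact hJ _ ht

/-- Convergence in `C^γ` is implied by uniform convergence of all derivatives inside the pieces. -/
theorem tendsto_of_tendstoUniformlyOn {f : ℕ → FSpace P γ} {g : FSpace P γ}
    (h : ∀ a i, P.toFun a = some i → ∀ b : ℕ, (b : ℕ∞) ≤ γ →
      TendstoUniformlyOn (fun n => iteratedFDeriv ℝ b (DFunLike.coe (F := CSpace m V γ) (f n) ∘ i.chart.symm))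
        (iteratedFDeriv ℝ b (DFunLike.coe (F := CSpace m V γ) g ∘ i.chart.symm)) atTop (interior i.K)) :
    Tendsto f atTop (𝓝 g) := by
  rw [← tendsto_sub_nhds_zero_iff]
  refine tendsto_zero_of_pieceSeminorm fun j => ?_
  rcases pieceSeminorm_cases P γ j with ⟨a, b, i, hb, -, -, hj⟩ | hj
  · rw [hj]
    -- The seminorm takes a supremum over the whole compact set, boundary included, so it is
    -- estimated by the interiors of finitely many pieces.
    obtain ⟨C, hC, A, hCA⟩ := exists_seminorm_le P (i.ofOrder b hb)
    refine Metric.tendsto_atTop.2 fun ε hε => ?_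
    set c := ε / (C + 1) with hc
    have hcpos : 0 < c := by positivity
    have h1 : ∀ᶠ n in atTop, ∀ a < A, ∀ ι, P.toFun a = some ι → ∀ b' ≤ b, ∀ z ∈ interior ι.K,
        ‖iteratedFDeriv ℝ b' (DFunLike.coe (F := CSpace m V γ) (f n - g) ∘ ι.chart.symm) z‖ ≤ c := by
      refine (eventually_all_finite (finite_lt_nat A)).2 fun a _ => ?_
      rcases hP : P.toFun a with _ | ι
      · simp
      · have h2 : ∀ᶠ n in atTop, ∀ b' ≤ b, ∀ z ∈ interior ι.K,
            ‖iteratedFDeriv ℝ b' (DFunLike.coe (F := CSpace m V γ) (f n - g) ∘ ι.chart.symm) z‖ ≤ c := by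
          refine (eventually_all_finite (finite_le_nat b)).2 fun b' hb' => ?_
          have hb'γ : (b' : ℕ∞) ≤ γ := le_trans (by exact_mod_cast hb') hb
          filter_upwards [Metric.tendstoUniformlyOn_iff.1 (h a ι hP b' hb'γ) c hcpos] with n hn z hz
          have h3 := hn z hz
          rw [dist_comm, dist_eq_norm] at h3
          have h4 := contDiffAt_comp_symm (m := m) (V := V) (f n) (ι.ofOrder b' hb'γ)
            (interior_subset hz)
          have h5 := contDiffAt_comp_symm (m := m) (V := V) g (ι.ofOrder b' hb'γ)
            (interior_subset hz)
          have h6 := iteratedFDeriv_sub_apply h4 h5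
          refine le_of_eq_of_le (congrArg norm h6) h3.le
        filter_upwards [h2] with n hn ι' hι'
        obtain rfl := Option.some.inj hι'
        exact hn
    obtain ⟨N, hN⟩ := eventually_atTop.1 h1
    refine ⟨N, fun n hn => ?_⟩
    rw [Real.dist_eq, sub_zero]
    refine (abs_of_nonneg (apply_nonneg (seminorm (i.ofOrder b hb)) _)).trans_lt ?_
    calc seminorm (i.ofOrder b hb) (f n - g) ≤ C * c := hCA _ c hcpos.le (hN n hn)
      _ < (C + 1) * c := by linarith
      _ = ε := by rw [hc]; field_simp
  · rw [hj]; exact tendsto_const_nhds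

/-- A Cauchy sequence has uniformly Cauchy derivatives in every piece. The pointwise limit is
therefore of class $C^\gamma$ in the interior of each piece, and these interiors cover `V`. -/
instance : CompleteSpace (FSpace P γ) := by
  refine Metric.complete_of_cauchySeq_tendsto fun f hf => ?_
  have hcauchy : ∀ a i, P.toFun a = some i → ∀ b : ℕ, (b : ℕ∞) ≤ γ →
      UniformCauchySeqOn (fun n => iteratedFDeriv ℝ b (DFunLike.coe (F := CSpace m V γ) (f n) ∘ i.chart.symm))
        atTop (interior i.K) := fun a i hi b hb => by
    refine Metric.uniformCauchySeqOn_iff.2 fun ε hε => ?_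
    obtain ⟨δ, hδ, h1⟩ := exists_forall_lt_of_fNorm_lt (pieceSeminorm P γ) hε (Nat.pair a b + 1)
    obtain ⟨N, hN⟩ := Metric.cauchySeq_iff.1 hf δ hδ
    refine ⟨N, fun n hn n' hn' z hz => ?_⟩
    have h2 := hN n hn n' hn'
    rw [dist_eq_norm] at h2
    have h3 := (norm_le_pieceSeminorm hi hb (f n - f n' : FSpace P γ) (interior_subset hz)).trans_lt
      (h1 _ h2 _ (Nat.lt_succ_self _))
    have h4 := contDiffAt_comp_symm (m := m) (V := V) (f n) (i.ofOrder b hb) (interior_subset hz)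
    have h5 := contDiffAt_comp_symm (m := m) (V := V) (f n') (i.ofOrder b hb) (interior_subset hz)
    have h6 := iteratedFDeriv_sub_apply h4 h5
    rw [dist_eq_norm]
    exact lt_of_eq_of_lt (congrArg norm h6.symm) h3
  have hpt : ∀ x : V, ∃ y, Tendsto (fun n => DFunLike.coe (F := CSpace m V γ) (f n) x) atTop (𝓝 y) :=
    fun x => by
      obtain ⟨a, i, hi, hx, hxK⟩ := P.cover x
      have h1 := (hcauchy a i hi 0 (by simp)).cauchySeq hxK
      obtain ⟨y, hy⟩ := cauchySeq_tendsto_of_complete h1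
      refine ⟨y.curry0, ?_⟩
      have h2 := ((continuousMultilinearCurryFin0 ℝ (EuclideanSpace ℝ (Fin m)) ℝ).continuous.tendsto
        y).comp hy
      refine h2.congr fun n => ?_
      change DFunLike.coe (F := CSpace m V γ) (f n) (i.chart.symm (i.chart x)) = _
      rw [i.chart.left_inv hx]
  choose F hF using hpt
  have key := fun a i (hi : P.toFun a = some i) =>
    contDiffOn_of_uniformCauchySeqOn (γ := γ) (U := interior i.K)
      (f := fun n => DFunLike.coe (F := CSpace m V γ) (f n) ∘ i.chart.symm) (g := F ∘ i.chart.symm)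
      isOpen_interior
      (fun n => by
        refine ContDiffOn.mono ?_ (interior_subset.trans i.K_subset)
        refine contDiffOn_iff_forall_nat_le.2 fun b hb => ?_
        exact contDiffOn_comp_symm (m := m) (V := V) (f n) (i.ofOrder b (by exact_mod_cast hb)))
      (hcauchy a i hi) (fun z _ => hF _)
  have hFs : ContMDiff (𝓡 m) 𝓘(ℝ, ℝ) (γ : WithTop ℕ∞) F := fun x => by
    obtain ⟨a, i, hi, hx, hxK⟩ := P.cover x
    have h1 : ContMDiffAt (𝓡 m) 𝓘(ℝ, ℝ) (γ : WithTop ℕ∞) (F ∘ i.chart.symm) (i.chart x) :=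
      ((key a i hi).1.contDiffAt (isOpen_interior.mem_nhds hxK)).contMDiffAt
    have h2 : ContMDiffAt (𝓡 m) (𝓡 m) (γ : WithTop ℕ∞) i.chart x :=
      (contMDiffAt_of_mem_maximalAtlas
        (IsManifold.subset_maximalAtlas (n := ∞) i.chart_mem) hx).of_le (by exact_mod_cast le_top)
    refine (h1.comp x h2).congr_of_eventuallyEq ?_
    filter_upwards [i.chart.open_source.mem_nhds hx] with y hy
    simp only [Function.comp_apply, i.chart.left_inv hy]
  exact ⟨(⟨F, hFs⟩ : ContMDiffMap (𝓡 m) 𝓘(ℝ, ℝ) V ℝ (γ : WithTop ℕ∞)),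
    tendsto_of_tendstoUniformlyOn fun a i hi b hb => (key a i hi).2 b hb⟩

theorem secondCountableTopology_continuousMultilinearMap (b : ℕ) : SecondCountableTopology
    (ContinuousMultilinearMap ℝ (fun _ : Fin b => EuclideanSpace ℝ (Fin m)) ℝ) := by
  have h1 : Module.Finite ℝ
      (ContinuousMultilinearMap ℝ (fun _ : Fin b => EuclideanSpace ℝ (Fin m)) ℝ) :=
    Module.Finite.of_injective (ContinuousMultilinearMap.toMultilinearMapLinear (R' := ℝ))
      ContinuousMultilinearMap.toMultilinearMap_injective
  have h2 := FiniteDimensional.proper ℝ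
    (ContinuousMultilinearMap ℝ (fun _ : Fin b => EuclideanSpace ℝ (Fin m)) ℝ)
  infer_instance

/-- The derivative of order `i.k` in the chart of `i`, on the compact set of `i`. -/
noncomputable def derivOn (i : SeminormIndex m V γ) (f : CSpace m V γ) :
    C(↥i.K, ContinuousMultilinearMap ℝ (fun _ : Fin i.k => EuclideanSpace ℝ (Fin m)) ℝ) where
  toFun y := iteratedFDeriv ℝ i.k ((f : V → ℝ) ∘ i.chart.symm) y
  continuous_toFun := continuous_iff_continuousAt.2 fun y =>
    ((f.contDiffAt_comp_symm i y.2).continuousAt_iteratedFDeriv le_rfl).comp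
      continuous_subtype_val.continuousAt

theorem dist_derivOn (i : SeminormIndex m V γ) (f g : CSpace m V γ) :
    dist (derivOn i f) (derivOn i g) = seminorm i (f - g) := by
  have h : ∀ y : ↥i.K, dist (derivOn i f y) (derivOn i g y)
      = ‖iteratedFDeriv ℝ i.k (((f - g : CSpace m V γ) : V → ℝ) ∘ i.chart.symm) y‖ := fun y => by
    rw [dist_eq_norm]
    exact congrArg norm (iteratedFDeriv_sub_apply (f.contDiffAt_comp_symm i y.2)
      (g.contDiffAt_comp_symm i y.2)).symm
  refine le_antisymm ((ContinuousMap.dist_le (apply_nonneg _ _)).2 fun y => ?_)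
    (seminorm_le_of_forall i _ dist_nonneg fun y hy => ?_)
  · rw [h]; exact norm_le_seminorm i _ y.2
  · rw [← h ⟨y, hy⟩]; exact ContinuousMap.dist_apply_le_dist _

/-- Derivatives on the pieces induce the topology from a countable product of spaces of continuous
maps from compact sets to finite-dimensional spaces. -/
instance : SecondCountableTopology (FSpace P γ) := by
  let T := {q : ℕ × ℕ // (P.toFun q.1).isSome ∧ (q.2 : ℕ∞) ≤ γ}
  let idx : T → SeminormIndex m V γ := fun q =>
    ((P.toFun q.1.1).get q.2.1).ofOrder q.1.2 q.2.2
  have hsc : ∀ q : T, SecondCountableTopology C(↥(idx q).K,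
      ContinuousMultilinearMap ℝ (fun _ : Fin (idx q).k => EuclideanSpace ℝ (Fin m)) ℝ) :=
    fun q => by
    have := secondCountableTopology_continuousMultilinearMap (m := m) (idx q).k
    infer_instance
  let Φ : FSpace P γ → ∀ q : T, C(↥(idx q).K,
      ContinuousMultilinearMap ℝ (fun _ : Fin (idx q).k => EuclideanSpace ℝ (Fin m)) ℝ) :=
    fun f q => derivOn (idx q) f
  have hΦ : IsInducing Φ := by
    refine isInducing_iff_nhds.2 fun f => le_antisymm ?_ ?_
    · refine map_le_iff_le_comap.1 (tendsto_pi_nhds.2 fun q => ?_)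
      refine (tendsto_iff_dist_tendsto_zero (α := C(↥(idx q).K,
        ContinuousMultilinearMap ℝ (fun _ : Fin (idx q).k => EuclideanSpace ℝ (Fin m)) ℝ))).2 ?_
      have h1 : Continuous fun g : FSpace P γ => seminorm (idx q) (g - f : FSpace P γ) :=
        (continuous_seminorm (idx q)).comp (continuous_sub_right f)
      have h2 : seminorm (idx q) (f - f : FSpace P γ) = 0 := by
        rw [sub_self]; exact map_zero (seminorm (idx q))
      have h3 := h1.tendsto f
      rw [h2] at h3
      exact h3.congr fun g => (dist_derivOn _ _ _).symm
    · change Tendsto id (comap Φ (𝓝 (Φ f))) (𝓝 f)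
      rw [← tendsto_sub_nhds_zero_iff]
      refine tendsto_zero_of_pieceSeminorm fun j => ?_
      rcases pieceSeminorm_cases P γ j with ⟨a, b, i, hb, -, hi, hj⟩ | hj
      · rw [hj]
        have hq : (P.toFun a).isSome := by rw [hi]; rfl
        have h1 : Tendsto (fun g => dist (Φ g ⟨(a, b), hq, hb⟩) (Φ f ⟨(a, b), hq, hb⟩))
            (comap Φ (𝓝 (Φ f))) (𝓝 0) :=
          tendsto_iff_dist_tendsto_zero.1 ((tendsto_pi_nhds.1 tendsto_comap) _)
        have h2 : idx ⟨(a, b), hq, hb⟩ = i.ofOrder b hb := by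
          simp only [idx, hi, Option.get_some]
        refine h1.congr fun g => ?_
        rw [← h2]
        exact dist_derivOn _ _ _
      · rw [hj]; exact tendsto_const_nhds
  exact hΦ.secondCountableTopology

end FSpace

/-! ### Inclusions between different orders of smoothness -/

/-- The inclusion of `C^γ(V)` into `C^β(V)`. -/
noncomputable def incl {β γ : ℕ∞} (h : β ≤ γ) : CSpace m V γ →ₗ[ℝ] CSpace m V β where
  toFun f := (⟨f, f.contMDiff.of_le (by exact_mod_cast h)⟩ :
    ContMDiffMap (𝓡 m) 𝓘(ℝ, ℝ) V ℝ (β : WithTop ℕ∞))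
  map_add' _ _ := rfl
  map_smul' _ _ := rfl

theorem seminorm_incl {β γ : ℕ∞} (h : β ≤ γ) (i : SeminormIndex m V β) (f : CSpace m V γ) :
    seminorm i (incl h f) = seminorm (⟨i.chart, i.chart_mem, i.K, i.isCompact_K, i.K_subset, i.k,
      i.k_le.trans h⟩ : SeminormIndex m V γ) f := rfl

theorem continuous_incl {β γ : ℕ∞} (h : β ≤ γ) :
    Continuous (incl h : CSpace m V γ →ₗ[ℝ] CSpace m V β) := by
  have h1 : IsTopologicalAddGroup (CSpace m V γ) := withSeminorms.topologicalAddGroup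
  exact withSeminorms.continuous_of_continuous_comp _ fun i => continuous_seminorm
    (⟨i.chart, i.chart_mem, i.K, i.isCompact_K, i.K_subset, i.k, i.k_le.trans h⟩ :
      SeminormIndex m V γ)

/-- A code `j` denotes the same piece and order for both classes, with value 0 when the order is too
high. This is why the F-norms grow with the order of smoothness. -/
theorem pieceSeminorm_incl_le (P : Pieces m V) {β γ : ℕ∞} (h : β ≤ γ) (j : ℕ) (f : CSpace m V γ) :
    pieceSeminorm P β j (incl h f) ≤ pieceSeminorm P γ j f := by
  rcases pieceSeminorm_cases P β j with ⟨a, b, i, hb, rfl, hi, hj⟩ | hj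
  · rw [hj, pieceSeminorm_eq hi (hb.trans h)]
    exact le_of_eq (seminorm_incl h _ f)
  · rw [hj]; exact apply_nonneg _ _

end CSpace

/-! ### `∞`-convex sets of differentiable functions -/

/-- Take the bounded sequence `x, y, y, …` with weights `a, b, 0, 0, …`. Limits of the infinite
construction are kept in the set by its $G_\delta$ description, so finite convexity suffices from
here on. -/
theorem IsInftyConvex.convex {E : Type u} [AddCommGroup E] [Module ℝ E] [TopologicalSpace E]
    [ContinuousSMul ℝ E] [T2Space E] {C : Set E} (hC : IsInftyConvex C) : Convex ℝ C := by
  intro x hx y hy a b ha hb hab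
  have hb1 : Bornology.IsVonNBounded ℝ (range fun i : ℕ => if i = 0 then x else y) := by
    refine ((finite_singleton y).insert x).isVonNBounded.subset ?_
    rintro _ ⟨i, rfl⟩
    by_cases h : i = 0 <;> simp [h]
  have hs : HasSum (fun i : ℕ => if i = 0 then a else if i = 1 then b else 0) 1 := by
    have h := hasSum_sum_of_ne_finset_zero (L := .unconditional ℕ) (s := Finset.range 2)
      (f := fun i : ℕ => if i = 0 then a else if i = 1 then b else 0) fun i hi => by
        have hi : 1 < i := by simpa using hi
        rw [if_neg (by omega), if_neg (by omega)]
    simpa [Finset.sum_range_succ, hab] using h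
  obtain ⟨z, hz, hlim⟩ := hC _ (fun i => by split_ifs <;> assumption) hb1 _
    (fun i => by split_ifs <;> first | assumption | exact le_rfl) hs
  have h2 : z = a • x + b • y := by
    refine tendsto_nhds_unique hlim (tendsto_const_nhds.congr' ?_)
    filter_upwards [eventually_ge_atTop 2] with N hN
    rw [← Finset.sum_subset (Finset.range_subset_range.2 hN) fun i _ hi => by
      have hi : 1 < i := by simpa using hi
      rw [if_neg (by omega), if_neg (by omega), zero_smul]]
    simp [Finset.sum_range_succ]
  exact h2 ▸ hz

namespace CSpace

variable {m : ℕ} {V : Type u} [TopologicalSpace V]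
  [ChartedSpace (EuclideanSpace ℝ (Fin m)) V]

theorem inter_eq_preimage {β γ : ℕ∞} (h : β ≤ γ) (S : Set (CSpace m V β)) :
    inter S γ = incl h ⁻¹' S := by
  ext f
  refine ⟨fun ⟨g, hg, hgf⟩ => ?_, fun hf => ⟨incl h f, hf, rfl⟩⟩
  have : incl h f = g := DFunLike.coe_injective hgf.symm
  rwa [mem_preimage, this]

variable [IsManifold (𝓡 m) ∞ V]

namespace FSpace

variable {P : Pieces m V} {β γ : ℕ∞}

/-- The inclusion of `C^γ(V)` into `C^β(V)`, which does not increase F-norms. -/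
noncomputable def incl (h : β ≤ γ) : FSpace P γ →ₗ[ℝ] FSpace P β := CSpace.incl (m := m) (V := V) h

/-- For a set `S` of `C^β` functions, the set `S ∩ C^γ(V)`, as a subset of `FSpace P γ`. -/
def inter (P : Pieces m V) (S : Set (CSpace m V β)) (γ : ℕ∞) : Set (FSpace P γ) := CSpace.inter S γ

omit [IsManifold (𝓡 m) ∞ V] in
theorem mem_inter_iff (h : β ≤ γ) {S : Set (CSpace m V β)} {f : FSpace P γ} :
    f ∈ inter P S γ ↔ CSpace.incl (m := m) (V := V) h f ∈ S :=
  Set.ext_iff.1 (CSpace.inter_eq_preimage h S) f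

theorem norm_incl_le (h : β ≤ γ) (f : FSpace P γ) : ‖incl h f‖ ≤ ‖f‖ :=
  fNorm_mono fun j => pieceSeminorm_incl_le P h j f

end FSpace

/-- The tower of the spaces `C^(n + k)(V)`. -/
theorem exists_spaceTower (P : Pieces m V) {l n : ℕ} (hln : l ≤ n)
    (C : Set (CSpace m V l)) (hconv : IsInftyConvex C) (hGδ : IsGδ C)
    (hne : (inter C n).Nonempty)
    (hdense : ∀ k : ℕ, n ≤ k → Dense (interIn (inter C ⊤) (inter C k)))
    (hsigmaZ : ∀ k : ℕ, n ≤ k → ∃ Y : Set ↥(inter C k), IsSigmaZSet Y ∧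
      interIn (inter C ((k + 1 : ℕ) : ℕ∞)) (inter C k) ⊆ Y) :
    ∃ τ : SpaceTower (FSpace P ⊤) (fun k => FSpace P ((n + k : ℕ) : ℕ∞)), τ.C = FSpace.inter P C n ∧
      ∀ w, τ.ι 0 w = FSpace.incl le_top w := by
  have hl : ∀ k : ℕ, (l : ℕ∞) ≤ ((n + k : ℕ) : ℕ∞) := fun k => by
    exact_mod_cast hln.trans (Nat.le_add_right n k)
  have hk : ∀ k : ℕ, ((n + 0 : ℕ) : ℕ∞) ≤ ((n + k : ℕ) : ℕ∞) := fun k => by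
    exact_mod_cast Nat.le_add_right n k
  have hinter : ∀ (γ : ℕ∞) (hγ : ((n + 0 : ℕ) : ℕ∞) ≤ γ) (f : FSpace P γ),
      FSpace.incl hγ f ∈ FSpace.inter P C ((n + 0 : ℕ) : ℕ∞) ↔ f ∈ FSpace.inter P C γ :=
    fun γ hγ f => (FSpace.mem_inter_iff (hl 0)).trans (FSpace.mem_inter_iff ((hl 0).trans hγ)).symm
  have hconv' : Convex ℝ (C : Set (FSpace P l)) := IsInftyConvex.convex (E := FSpace P l) hconv
  have hcv : Convex ℝ (FSpace.inter P C ((n + 0 : ℕ) : ℕ∞)) := fun f hf g hg a b ha hb hab =>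
    (FSpace.mem_inter_iff (hl 0)).2 (hconv' ((FSpace.mem_inter_iff (hl 0)).1 hf)
      ((FSpace.mem_inter_iff (hl 0)).1 hg) ha hb hab)
  obtain ⟨O, hO, hCO⟩ : ∃ O : ℕ → Set (CSpace m V n), (∀ i, IsOpen (O i)) ∧ inter C n = ⋂ i, O i := by
    obtain ⟨O, hO, hCO⟩ := isGδ_iff_eq_iInter_nat.1 hGδ
    refine ⟨fun i => CSpace.incl (hl 0) ⁻¹' O i, fun i => (hO i).preimage (continuous_incl (hl 0)), ?_⟩
    rw [← preimage_iInter, ← hCO]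
    exact inter_eq_preimage (hl 0) C
  have hU : ∀ k : ℕ, ∃ U : ℕ → Set (FSpace P ((n + k : ℕ) : ℕ∞)), (∀ j, IsOpen (U j)) ∧
      (∀ j, ApproxInto (FSpace.inter P C ((n + k : ℕ) : ℕ∞)) (U j)) ∧
      ∀ f ∈ FSpace.inter P C ((n + k : ℕ) : ℕ∞),
        -- Having a preimage at level `k + 1` means being of class $C^{n+k+1}$, hence lying in the
        -- $\sigma Z$-set and in one of its Z-sets.
        FSpace.incl (hk k) f ∈ range (FSpace.incl (P := P) (hk (k + 1))) → ∃ j, f ∉ U j := fun k => by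
    obtain ⟨Y, ⟨Z, hZ, rfl⟩, hY⟩ := hsigmaZ (n + k) (Nat.le_add_right n k)
    choose U hUo hUm hUa using fun j =>
      IsZSet.exists_approxInto (G := FSpace P ((n + k : ℕ) : ℕ∞)) (hZ j)
    refine ⟨U, hUo, hUa, fun f hf ⟨g, hg⟩ => ?_⟩
    have hgf : (CSpace.incl (hk (k + 1)) g : V → ℝ) = CSpace.incl (hk k) f := congrArg DFunLike.coe hg
    have hgf' : DFunLike.coe (F := CSpace m V ((n + (k + 1) : ℕ) : ℕ∞)) g
      = DFunLike.coe (F := CSpace m V ((n + k : ℕ) : ℕ∞)) f := hgf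
    obtain ⟨c, hc, hcf⟩ := hf
    obtain ⟨j, hj⟩ := mem_iUnion.1 (hY (a := ⟨f, ⟨c, hc, hcf⟩⟩) ⟨g, ⟨c, hc, hcf.trans hgf'.symm⟩, hgf'⟩)
    exact ⟨j, (hUm j _).1 hj⟩
  choose U hUo hUa hUc using hU
  refine ⟨{
    ι := fun k => FSpace.incl le_top
    J := fun k => FSpace.incl (hk k)
    norm_ι_le := fun k w => FSpace.norm_incl_le le_top w
    norm_ι_mono := fun {k k'} h w => FSpace.norm_incl_le (P := P)
      (show ((n + k : ℕ) : ℕ∞) ≤ ((n + k' : ℕ) : ℕ∞) by exact_mod_cast Nat.add_le_add_left h n)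
      (FSpace.incl le_top w)
    norm_J_le := fun k f => FSpace.norm_incl_le (hk k) f
    J_ι := fun k w => rfl
    J_zero := fun f => rfl
    ι_injective := fun w w' h => DFunLike.coe_injective (F := CSpace m V ⊤)
      (congrArg (DFunLike.coe (F := CSpace m V ((n + 0 : ℕ) : ℕ∞))) h)
    mem_range_ι := fun z hz => ?_
    C := FSpace.inter P C ((n + 0 : ℕ) : ℕ∞)
    convex_C := hcv
    nonempty_C := hne
    O := O
    isOpen_O := hO
    C_eq := hCO
    dense := fun k f hf => ?_
    U := U
    isOpen_U := hUo
    approxInto_U := fun k j => ?_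
    exists_notMem_U := fun k f hf => hUc k f ((hinter _ (hk k) f).1 hf) }, rfl, fun w => rfl⟩
  -- A function in the range of `J k` for all `k` is of class $C^{n+k}$ for all `k`, hence smooth.
  · have h : ContMDiff (𝓡 m) 𝓘(ℝ, ℝ) ∞ (DFunLike.coe (F := CSpace m V ((n + 0 : ℕ) : ℕ∞)) z) :=
      contMDiff_infty.2 fun k => by
        obtain ⟨g, rfl⟩ := hz k
        exact (CSpace.contMDiff (m := m) (V := V) g).of_le (by exact_mod_cast Nat.le_add_left k n)
    exact ⟨(⟨_, h⟩ : ContMDiffMap (𝓡 m) 𝓘(ℝ, ℝ) V ℝ ∞), rfl⟩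
  · have hf' := (hinter _ (hk k) f).1 hf
    have h := closure_subtype.1 (hdense (n + k) (Nat.le_add_right n k) ⟨f, hf'⟩)
    refine closure_mono ?_ h
    rintro _ ⟨g, ⟨w, hw, hwg⟩, rfl⟩
    exact ⟨w, (hinter ⊤ le_top w).2 hw, DFunLike.coe_injective (F := CSpace m V ((n + k : ℕ) : ℕ∞)) hwg⟩
  · rw [show {f : FSpace P ((n + k : ℕ) : ℕ∞) | FSpace.incl (hk k) f ∈
      FSpace.inter P C ((n + 0 : ℕ) : ℕ∞)} = FSpace.inter P C ((n + k : ℕ) : ℕ∞) from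
      Set.ext fun f => hinter _ (hk k) f]
    exact hUa k j

end CSpace

/-! ### Universality -/

theorem IsClosed.exists_continuous_eq_zero_iff {K : Type*} [TopologicalSpace K]
    [TopologicalSpace.MetrizableSpace K] {A : Set K} (hA : IsClosed A) :
    ∃ φ : K → ℝ, Continuous φ ∧ (∀ x, φ x ∈ Icc (0 : ℝ) 1) ∧ ∀ x, φ x = 0 ↔ x ∈ A := by
  let _ := TopologicalSpace.metrizableSpaceMetric K
  rcases A.eq_empty_or_nonempty with rfl | hne
  · exact ⟨fun _ => 1, continuous_const, fun _ => ⟨zero_le_one, le_rfl⟩, by simp⟩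
  · refine ⟨fun x => min 1 (Metric.infDist x A), continuous_const.min (Metric.continuous_infDist_pt A),
      fun x => ⟨le_min zero_le_one Metric.infDist_nonneg, min_le_left _ _⟩, fun x => ?_⟩
    rw [hA.mem_iff_infDist_zero hne]
    refine ⟨fun h => ?_, fun h => by simp [h]⟩
    rcases min_choice 1 (Metric.infDist x A) with h' | h'
    · exact absurd (h'.symm.trans h) one_ne_zero
    · exact h'.symm.trans h

/-- Each closed set is the zero set of a function to `[0, 1]`; partial products have the increasing
finite unions as zero sets. -/
theorem IsFSigmaDelta.exists_functions {K : Type*} [TopologicalSpace K]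
    [TopologicalSpace.MetrizableSpace K] {S : Set K} (hS : IsFSigmaDelta S) :
    ∃ φ : ℕ → ℕ → K → ℝ, (∀ k i, Continuous (φ k i)) ∧ (∀ k i x, φ k i x ∈ Icc (0 : ℝ) 1) ∧
      (∀ k i x, φ k i x = 0 → φ k (i + 1) x = 0) ∧ ∀ x, x ∈ S ↔ ∀ k, ∃ i, φ k i x = 0 := by
  obtain ⟨F, hF, rfl⟩ := hS
  choose ψ hψc hψ hψF using fun k j => (hF k j).exists_continuous_eq_zero_iff
  refine ⟨fun k i x => ∏ j ∈ Finset.range (i + 1), ψ k j x,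
    fun k i => continuous_finsetProd _ fun j _ => hψc k j,
    fun k i x => ⟨Finset.prod_nonneg fun j _ => (hψ k j x).1,
      Finset.prod_le_one (fun j _ => (hψ k j x).1) fun j _ => (hψ k j x).2⟩,
    fun k i x h => (Finset.prod_range_succ _ _).trans (mul_eq_zero_of_left h _), fun x => ?_⟩
  simp only [mem_iInter, mem_iUnion, Finset.prod_eq_zero_iff, hψF]
  refine forall_congr' fun k => ⟨fun ⟨j, hj⟩ => ⟨j, j, by simp, hj⟩, fun ⟨_, j, _, hj⟩ => ⟨j, hj⟩⟩

theorem mainTheorem10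
    (m : ℕ) (V : Type u) [TopologicalSpace V] [T2Space V] [SigmaCompactSpace V]
    [ChartedSpace (EuclideanSpace ℝ (Fin m)) V] [IsManifold (𝓡 m) ∞ V]
    (l n : ℕ) (hln : l ≤ n)
    (C : Set (CSpace m V l)) (hconv : IsInftyConvex C) (hGδ : IsGδ C)
    (hne : (CSpace.inter C n).Nonempty)
    (hdense : ∀ k : ℕ, n ≤ k →
      Dense (CSpace.interIn (CSpace.inter C ⊤) (CSpace.inter C k)))
    (hsigmaZ : ∀ k : ℕ, n ≤ k → ∃ Y : Set ↥(CSpace.inter C k),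
      IsSigmaZSet Y ∧
        CSpace.interIn (CSpace.inter C ((k + 1 : ℕ) : ℕ∞)) (CSpace.inter C k) ⊆ Y)
    (X : Type v) [TopologicalSpace X] [T2Space X]
    (f : ↥(CSpace.inter C n) → X)
    (hf : Continuous f) (hinj : Function.Injective f) :
    IsM2Universal.{v, w} (f '' CSpace.interIn (CSpace.inter C ⊤) (CSpace.inter C n)) := by
  obtain ⟨P⟩ := CSpace.exists_pieces m V
  obtain ⟨τ, hτC, hτι⟩ := CSpace.exists_spaceTower P hln C hconv hGδ hne hdense hsigmaZ
  rintro M _ ⟨K, _, _, _, S, hS, ⟨e⟩⟩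
  obtain ⟨φ, hφc, hφ, hφm, hφS⟩ := hS.exists_functions
  obtain ⟨g, hg, hginj, hgC, hgS⟩ := τ.exists_injective_map hφc hφ hφm
  let g' : K → ↥(CSpace.inter C n) := fun x => ⟨g x, Set.ext_iff.1 hτC _ |>.1 (hgC x)⟩
  have hg' : Continuous g' := hg.subtype_mk _
  have hemb : IsClosedEmbedding (f ∘ g') := (hf.comp hg').isClosedEmbedding
    (hinj.comp fun x y h => hginj (congrArg Subtype.val h))
  have hmem : ∀ x, g' x ∈ CSpace.interIn (CSpace.inter C ⊤) (CSpace.inter C n) ↔ x ∈ S := fun x => by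
    rw [hφS, ← hgS]
    constructor
    · rintro ⟨w, -, hw⟩
      exact ⟨w, (hτι w).trans (DFunLike.coe_injective (F := CSpace m V n) hw)⟩
    · rintro ⟨w, hw⟩
      have hw' : DFunLike.coe (F := CSpace m V ⊤) w = DFunLike.coe (F := CSpace m V n) (g' x).1 :=
        congrArg (DFunLike.coe (F := CSpace m V n)) ((hτι w).symm.trans hw)
      obtain ⟨c, hc, hcg⟩ := (g' x).2
      exact ⟨w, ⟨c, hc, hcg.trans hw'.symm⟩, hw'⟩
  let h : S → ↥(f '' CSpace.interIn (CSpace.inter C ⊤) (CSpace.inter C n)) := fun x =>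
    ⟨f (g' x), mem_image_of_mem f ((hmem x).2 x.2)⟩
  have hh : IsEmbedding h := (hemb.isEmbedding.comp .subtypeVal).codRestrict _ _
  refine ⟨range h, ?_, ⟨e.trans hh.toHomeomorph⟩⟩
  -- By injectivity of `f`, a point of `f(g(K))` in the image of the smooth functions comes from a
  -- smooth `g x`, that is, from `x ∈ S`.
  have hr : range h = Subtype.val ⁻¹' range (f ∘ g') := by
    ext y
    constructor
    · rintro ⟨x, rfl⟩
      exact ⟨x, rfl⟩
    · rintro ⟨x, hx⟩
      obtain ⟨z, hz, hzy⟩ := y.2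
      have hxz : g' x = z := hinj (hx.trans hzy.symm)
      exact ⟨⟨x, (hmem x).1 (hxz ▸ hz)⟩, Subtype.ext hx⟩
  rw [hr]
  exact hemb.isClosed_range.preimage continuous_subtype_val
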